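/- Let $n \ge 3$, let $X=\{x_1,\dots,x_n\}$ be a set of $n$ input nodes and $Y=\{y_1,\dots,y_n\}$ a set of $n$ output nodes; all other nodes are unlabelled. For a finite directed graph $G$ and a node $a$, let $E(a,G)$ be the subgraph whose nodes are those from which $a$ is reachable and whose edges are those of $G$ whose head can reach $a$. A directed binary tree is a rooted tree in which every node has zero or two children and all of whose edges are directed from child to parent. A structure for computing $(y_1,\dots,y_n)$ is a finite directed acyclic graph $S$ such that (i) a node lies in $X$ if and only if it has no incoming edge; (ii) for every node $a$, $E(a,S)$ is a directed binary tree (with root $a$); (iii) for any two different nodes $a,b$, there is no isomorphism between $E(a,S)$ and $E(b,S)$ that respects the input labels; (iv) the nodes outside $X$ without outgoing edges are exactly $y_1,\dots,y_n$, and for each $j$ the set of leaves of $E(y_j,S)$ is $X\setminus\{x_j\}$. Let $\mathcal S_n$ be the set of these structures. The complexity $c(S)$ is the number of nodes of $S$ outside $X$, and the latency $l(S)$ is the length (number of edges) of the longest simple directed path in $S$. Let $\mathcal S_n^{\mathrm{co}}=\{S\in\mathcal S_n : c(S)=\min_{S'\in\mathcal S_n}c(S')\}$ be the set of complexity-optimal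 structures. A T-tree is a finite (undirected) tree whose leaves are exactly $x_1,\dots,x_n$ and each of whose internal nodes has exactly three edges. Let $\mathcal T_n$ be the set of T-trees, and let the diameter $d(T)$ be the length of the longest simple path in $T$. Theorem. Let $n\ge 3$ and $\delta=\lfloor\log_2(n/2)\rfloor$. Then $\min_{S\in\mathcal S_n}c(S)=3n-6$, and $$\min_{S\in\mathcal S_n^{\mathrm{co}}} l(S)\;=\;\min_{T\in\mathcal T_n} d(T)-1\;=\;\delta+\lceil\log_2(n-2^{\delta})\rceil .$$ All these minima are attained. -/

import Mathlib

/-! Directed graphs are Mathlib's `Digraph`; nodes carry no further labels than those given by the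
families of input nodes `x₁, …, xₙ` and output nodes `y₁, …, yₙ`, indexed by `Fin n`. -/

namespace NodeComputation

/-- `b` is reachable from `a` by a directed path, possibly of length zero. -/
def Reach {V : Type} (G : Digraph V) (a b : V) : Prop :=
  Relation.ReflTransGen G.Adj a b

/-- No node lies on a closed directed path of positive length (so there are no self-loops either). -/
def IsAcyclic {V : Type} (G : Digraph V) : Prop :=
  ∀ a : V, ¬ Relation.TransGen G.Adj a a

/-- The subgraph `E(a, G)` entering `a`: its nodes are those from which `a` is reachable, and its
edges are all the edges of `G` between them (an edge whose head can reach `a` has a tail that can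
reach `a`). -/
def entering {V : Type} (G : Digraph V) (a : V) : Digraph {b : V // Reach G b a} where
  Adj u v := G.Adj u.1 v.1

/-- `H` is a directed (full) binary tree with root `r`, its edges pointing from child to parent:
every node reaches the root, the root has no parent, every other node has exactly one parent, and
every node has either zero or two children. -/
structure IsDBT {W : Type} (H : Digraph W) (r : W) : Prop where
  reach_root : ∀ v : W, Reach H v r
  root_no_parent : ∀ v : W, ¬ H.Adj r v
  unique_parent : ∀ v : W, v ≠ r → ∃! p : W, H.Adj v p
  children : ∀ v : W, {c : W | H.Adj c v} = ∅ ∨ {c : W | H.Adj c v}.ncard = 2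

/-- The leaves of a directed binary tree: the nodes without children. -/
def leaves {W : Type} (H : Digraph W) : Set W :=
  {v : W | ∀ c : W, ¬ H.Adj c v}

/-- `E(a, G)` and `E(b, G)` are the same partially unlabelled graph, the labelled nodes being those
in `X`: they are isomorphic by an isomorphism that respects the labels. -/
def SameSubtree {V : Type} (G : Digraph V) (X : Set V) (a b : V) : Prop :=
  ∃ φ : {c : V // Reach G c a} ≃ {c : V // Reach G c b},
    (∀ u v, (entering G a).Adj u v ↔ (entering G b).Adj (φ u) (φ v)) ∧
    ∀ u, (u.1 ∈ X ∨ (φ u).1 ∈ X) → (φ u).1 = u.1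

/-- A directed acyclic graph with set `X` of input nodes is a structure: the inputs are exactly the
nodes without incoming edges, every `E(a, G)` is a directed binary tree, and different nodes have
different subtrees. -/
structure IsStructure {V : Type} (G : Digraph V) (X : Set V) : Prop where
  acyclic : IsAcyclic G
  mem_inputs_iff : ∀ a : V, a ∈ X ↔ ∀ b : V, ¬ G.Adj b a
  entering_isDBT : ∀ a : V, IsDBT (entering G a) ⟨a, Relation.ReflTransGen.refl⟩
  not_same : ∀ a b : V, a ≠ b → ¬ SameSubtree G X a b

/-- The structures used for computing `y = (y₁, …, yₙ)` from `x = (x₁, …, xₙ)`: the output nodes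
(the computation nodes without outgoing edges) are exactly `y₁, …, yₙ`, and `E(yⱼ)` is a (directed
binary) tree with set of leaves `X \ {xⱼ}`. -/
structure NodeStructure (n : ℕ) where
  Node : Type
  finite_node : Finite Node
  graph : Digraph Node
  x : Fin n ↪ Node
  y : Fin n ↪ Node
  isStructure : IsStructure graph (Set.range x)
  outputs : {a : Node | a ∉ Set.range x ∧ ∀ b : Node, ¬ graph.Adj a b} = Set.range y
  leaves_y : ∀ j : Fin n,
    Subtype.val '' leaves (entering graph (y j)) = Set.range x \ {x j}

/-- The complexity of a structure: the number of its computation (that is, non-input) nodes. -/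
noncomputable def NodeStructure.complexity {n : ℕ} (S : NodeStructure n) : ℕ :=
  {a : S.Node | a ∉ Set.range S.x}.ncard

/-- `G` has a simple directed path `(v₀, …, vₖ)` of length `k`. -/
def HasSimplePath {V : Type} (G : Digraph V) (k : ℕ) : Prop :=
  ∃ v : Fin (k + 1) → V, Function.Injective v ∧ ∀ i : Fin k, G.Adj (v i.castSucc) (v i.succ)

/-- The latency of a structure: the length of its longest simple path (the set of these lengths is
bounded, since there are finitely many nodes). -/
noncomputable def NodeStructure.latency {n : ℕ} (S : NodeStructure n) : ℕ :=
  sSup {k : ℕ | HasSimplePath S.graph k}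

/-- The complexity-optimal structures: those of minimum complexity among all structures for `n`. -/
def complexityOptimal (n : ℕ) : Set (NodeStructure n) :=
  {S | ∀ S' : NodeStructure n, S.complexity ≤ S'.complexity}

/-- A T-tree: a finite tree whose leaves (nodes with exactly one edge) are exactly `x₁, …, xₙ`, and
whose internal nodes (nodes with more than one edge) all have exactly three edges. -/
structure TTree (n : ℕ) where
  Node : Type
  finite_node : Finite Node
  graph : SimpleGraph Node
  isTree : graph.IsTree
  x : Fin n ↪ Node
  leaf_iff : ∀ v : Node, (graph.neighborSet v).ncard = 1 ↔ v ∈ Set.range x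
  internal : ∀ v : Node, 1 < (graph.neighborSet v).ncard → (graph.neighborSet v).ncard = 3

/-- The diameter of a T-tree: the length of its longest simple path. -/
noncomputable def TTree.diameter {n : ℕ} (T : TTree n) : ℕ :=
  sSup {k : ℕ | ∃ (u v : T.Node) (p : T.graph.Walk u v), p.IsPath ∧ p.length = k}

end NodeComputation

/-! Send each node to the set of inputs that reach it. Since every `E(a, G)` is a binary tree, the
computation nodes yield a family of proper subsets of an `n`-set, each with at least two elements
and each the disjoint union of two members or singletons, containing every complement of a point
(`leaveOneOutFamily`). Deleting a point `i` from the ground set costs such a family at least three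
members: the complement of `i`, and at least two members of the form `{i} ∪ D` with `D` a member or
singleton, which become redundant. Induction from three points gives `3n - 6`
(`three_mul_card_sub_six_le`).

In a family of size exactly `3n - 6` each deletion costs exactly three, so every trace on at least
three points is again optimal. Counting on four points shows that two members never cross as splits
(`compatible`). Hence the family is closed under complements up to singletons (`sdiff_memOrUnit`)
and its splittings are unique (`split_unique`). In an optimal structure the input sets therefore
determine the nodes, and complementation is a duality that reverses edges (`adj_dual`).

Cut a longest path, of length `l`, at its `m`-th node `a`. The tree of `a` has height at most `m`
and, by duality, that of its dual has height at most `l - m`. Their input sets are complementary, so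
`n ≤ 2^m + 2^(l-m)` for all `m ≤ l`. Taking `m = l / 2` bounds the latency from below.

Conversely, the oriented edges of a T-tree, with non-backtracking succession, form an optimal
structure whose latency is less than the diameter (`TTree.exists_nodeStructure`). This transfers the
lower bound to diameters, and a balanced heap-shaped T-tree attains both bounds. -/

namespace NodeComputation

section

open Finset

/-! ### Leave-one-out set families and their minimum size -/

section SetFamilies

variable {α : Type*} [DecidableEq α]

/-- `A` belongs to `F` or is a singleton. -/
def MemOrUnit (F : Finset (Finset α)) (A : Finset α) : Prop := A ∈ F ∨ #A = 1

/-- A family of proper subsets of `Z` with at least two elements, each a disjoint union of two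
members or singletons, which contains every `Z \ {j}`. -/
structure LeaveOneOutFamily (Z : Finset α) (F : Finset (Finset α)) : Prop where
  subset : ∀ A ∈ F, A ⊆ Z
  two_le : ∀ A ∈ F, 2 ≤ #A
  card_lt : ∀ A ∈ F, #A < #Z
  split : ∀ A ∈ F, ∃ B C, Disjoint B C ∧ B ∪ C = A ∧ MemOrUnit F B ∧ MemOrUnit F C
  erase_mem : ∀ j ∈ Z, Z.erase j ∈ F

/-- The nontrivial traces on `Z` of the members of `F`. -/
def trace (Z : Finset α) (F : Finset (Finset α)) : Finset (Finset α) :=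
  (F.image (· ∩ Z)).filter fun A => 2 ≤ #A ∧ #A < #Z

lemma mem_trace {Z : Finset α} {F : Finset (Finset α)} {A : Finset α} :
    A ∈ trace Z F ↔ (∃ B ∈ F, B ∩ Z = A) ∧ 2 ≤ #A ∧ #A < #Z := by
  simp [trace]

/-- The members of `F` obtained by adding the point `i` to a member or singleton. -/
def pointExtensions (F : Finset (Finset α)) (i : α) : Finset (Finset α) :=
  F.filter fun A => i ∈ A ∧ (A.erase i ∈ F ∨ #(A.erase i) = 1)

namespace LeaveOneOutFamily

variable {Z : Finset α} {F : Finset (Finset α)}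

lemma memOrUnit_nonempty (h : LeaveOneOutFamily Z F) {A : Finset α} (hA : MemOrUnit F A) :
    A.Nonempty := by
  rw [← card_pos]
  rcases hA with hA | hA
  · have := h.two_le A hA; omega
  · omega

lemma mem_of_memOrUnit {A : Finset α} (hA : MemOrUnit F A) (h2 : 2 ≤ #A) : A ∈ F := by
  rcases hA with hA | hA
  · exact hA
  · omega

/-- Keep splitting and follow the part containing `i`. When that part becomes `{i}`, the set just
split is a point extension. -/
lemma exists_pointExtension_subset (h : LeaveOneOutFamily Z F) {i : α} :
    ∀ (k : ℕ) (C : Finset α), #C = k → C ∈ F → i ∈ C → ∃ A ∈ pointExtensions F i, A ⊆ C := by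
  intro k
  induction k using Nat.strong_induction_on with
  | _ k ih =>
    intro C hk hC hi
    obtain ⟨B, D, hd, hu, hB, hD⟩ := h.split C hC
    wlog hiB : i ∈ B generalizing B D
    · refine this D B hd.symm (by rw [union_comm]; exact hu) hD hB ?_
      rw [← hu, mem_union] at hi
      tauto
    have hcard : #B + #D = #C := by rw [← hu, card_union_of_disjoint hd]
    have hDpos := card_pos.2 (h.memOrUnit_nonempty hD)
    rcases hB with hB | hB
    · obtain ⟨A, hA, hAB⟩ := ih #B (by omega) B rfl hB hiB
      exact ⟨A, hA, hAB.trans (hu ▸ subset_union_left)⟩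
    · obtain ⟨b, rfl⟩ := card_eq_one.1 hB
      obtain rfl : i = b := by simpa using hiB
      refine ⟨C, ?_, subset_rfl⟩
      have : C.erase i = D := by
        rw [← hu, erase_union_distrib]
        have : i ∉ D := by simpa using hd
        simp [erase_eq_of_notMem this]
      simp only [pointExtensions, mem_filter]
      refine ⟨hC, hi, ?_⟩
      rw [this]
      exact hD

lemma exists_pointExtension_notMem (h : LeaveOneOutFamily Z F) {i j : α} (hi : i ∈ Z) (hj : j ∈ Z)
    (hij : i ≠ j) : ∃ A ∈ pointExtensions F i, j ∉ A := by
  obtain ⟨A, hA, hAC⟩ := h.exists_pointExtension_subset (i := i) _ (Z.erase j) rfl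
    (h.erase_mem j hj) (mem_erase.2 ⟨hij, hi⟩)
  exact ⟨A, hA, fun hjA => by simpa using hAC hjA⟩

/-- A first extension contains some `k ≠ i`; a second one, found inside `Z.erase k`, avoids `k`. -/
lemma two_le_card_pointExtensions (h : LeaveOneOutFamily Z F) {i : α} (hi : i ∈ Z)
    (hZ : 3 ≤ #Z) : 2 ≤ #(pointExtensions F i) := by
  obtain ⟨j, hj, hji⟩ := exists_mem_ne (by omega : 1 < #Z) i
  obtain ⟨A, hA, -⟩ := h.exists_pointExtension_notMem hi hj hji.symm
  have hA' := (mem_filter.1 hA)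
  obtain ⟨k, hk, hki⟩ := exists_mem_ne (h.two_le A hA'.1) i
  obtain ⟨B, hB, hkB⟩ := h.exists_pointExtension_notMem hi (h.subset A hA'.1 hk) hki.symm
  exact one_lt_card.2 ⟨A, hA, B, hB, fun e => hkB (e ▸ hk)⟩

lemma inter_erase_eq (h : LeaveOneOutFamily Z F) {A : Finset α} (hA : A ∈ F) (i : α) :
    A ∩ Z.erase i = A.erase i := by
  rw [inter_erase, inter_eq_left.2 (h.subset A hA)]

/-- The trace is already the image of what remains after discarding `Z.erase i`, whose trace is
everything, and the point extensions `A`, since `A.erase i` is too small or is itself a member with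
the same trace. -/
lemma card_trace_erase_add_le (h : LeaveOneOutFamily Z F) {i : α} (hi : i ∈ Z) :
    #(trace (Z.erase i) F) + 1 + #(pointExtensions F i) ≤ #F := by
  have hKF : pointExtensions F i ⊆ F := filter_subset _ _
  have hnot : Z.erase i ∉ pointExtensions F i := by simp [pointExtensions]
  have hsub : insert (Z.erase i) (pointExtensions F i) ⊆ F :=
    insert_subset (h.erase_mem i hi) hKF
  have key : trace (Z.erase i) F ⊆
      (F \ insert (Z.erase i) (pointExtensions F i)).image (·.erase i) := by
    intro T hT
    obtain ⟨⟨A, hA, rfl⟩, h2, hlt⟩ := mem_trace.1 hT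
    rw [h.inter_erase_eq hA] at h2 hlt ⊢
    by_cases hK : A ∈ pointExtensions F i
    · have hm := (mem_filter.1 hK).2.2
      have hF : A.erase i ∈ F := by
        rcases hm with hm | hm
        · exact hm
        · omega
      refine mem_image.2 ⟨A.erase i, mem_sdiff.2 ⟨hF, ?_⟩, by simp⟩
      rw [mem_insert, not_or]
      refine ⟨fun e => ?_, by simp [pointExtensions]⟩
      rw [e] at hlt
      omega
    · refine mem_image.2 ⟨A, mem_sdiff.2 ⟨hA, ?_⟩, rfl⟩
      rw [mem_insert, not_or]
      refine ⟨fun e => ?_, hK⟩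
      rw [e] at hlt
      simp at hlt
  have h1 := (card_le_card key).trans card_image_le
  rw [card_sdiff_of_subset hsub, card_insert_of_notMem hnot] at h1
  have h3 := card_le_card hsub
  rw [card_insert_of_notMem hnot] at h3
  omega

/-- A splitting survives the deletion of `i` unless one part was `{i}`. In that case the other part
has the same trace and is split instead, whence the induction on size. -/
lemma trace_erase (h : LeaveOneOutFamily Z F) {i : α} (hi : i ∈ Z) (hZ : 4 ≤ #Z) :
    LeaveOneOutFamily (Z.erase i) (trace (Z.erase i) F) := by
  have hcZ := card_erase_of_mem hi
  refine ⟨?_, fun A hA => (mem_trace.1 hA).2.1, fun A hA => (mem_trace.1 hA).2.2, ?_, ?_⟩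
  · intro A hA
    obtain ⟨⟨B, -, rfl⟩, -⟩ := mem_trace.1 hA
    exact inter_subset_right
  · have main : ∀ (k : ℕ) (A : Finset α), #A = k → A ∈ F → 2 ≤ #(A.erase i) →
        #(A.erase i) < #(Z.erase i) → ∃ B C, Disjoint B C ∧ B ∪ C = A.erase i ∧
          MemOrUnit (trace (Z.erase i) F) B ∧ MemOrUnit (trace (Z.erase i) F) C := by
      intro k
      induction k using Nat.strong_induction_on with
      | _ k ih =>
        intro A hk hA h2 hlt
        obtain ⟨B, C, hd, hu, hB, hC⟩ := h.split A hA
        have hcard : #B + #C = #A := by rw [← hu, card_union_of_disjoint hd]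
        have hBpos := card_pos.2 (h.memOrUnit_nonempty hB)
        have hCpos := card_pos.2 (h.memOrUnit_nonempty hC)
        have hdu : B.erase i ∪ C.erase i = A.erase i := by rw [← hu, erase_union_distrib]
        have hdd : Disjoint (B.erase i) (C.erase i) :=
          hd.mono (erase_subset _ _) (erase_subset _ _)
        have hdc : #(B.erase i) + #(C.erase i) = #(A.erase i) := by
          rw [← hdu, card_union_of_disjoint hdd]
        rcases Nat.eq_zero_or_pos #(B.erase i) with hB0 | hB0
        · have hCA : C.erase i = A.erase i := by
            rw [← hdu, card_eq_zero.1 hB0, empty_union]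
          have hCF : C ∈ F := mem_of_memOrUnit hC
            (by rw [← hCA] at h2; exact h2.trans (card_le_card (erase_subset _ _)))
          rw [← hCA] at h2 hlt ⊢
          exact ih _ (by omega) C rfl hCF h2 hlt
        rcases Nat.eq_zero_or_pos #(C.erase i) with hC0 | hC0
        · have hCA : B.erase i = A.erase i := by
            rw [← hdu, card_eq_zero.1 hC0, union_empty]
          have hCF : B ∈ F := mem_of_memOrUnit hB
            (by rw [← hCA] at h2; exact h2.trans (card_le_card (erase_subset _ _)))
          rw [← hCA] at h2 hlt ⊢
          exact ih _ (by omega) B rfl hCF h2 hlt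
        have piece : ∀ D, MemOrUnit F D → 0 < #(D.erase i) → #(D.erase i) < #(Z.erase i) →
            MemOrUnit (trace (Z.erase i) F) (D.erase i) := by
          intro D hD h0 hl
          by_cases h1 : #(D.erase i) = 1
          · exact Or.inr h1
          · have hDF : D ∈ F := mem_of_memOrUnit hD
              (by have := card_le_card (erase_subset i D); omega)
            exact Or.inl (mem_trace.2 ⟨⟨D, hDF, h.inter_erase_eq hDF i⟩, by omega, hl⟩)
        exact ⟨_, _, hdd, hdu, piece B hB hB0 (by omega), piece C hC hC0 (by omega)⟩
    intro A hA
    obtain ⟨⟨B, hB, rfl⟩, h2, hlt⟩ := mem_trace.1 hA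
    rw [h.inter_erase_eq hB] at h2 hlt ⊢
    exact main _ B rfl hB h2 hlt
  · intro j hj
    have hj' := mem_erase.1 hj
    refine mem_trace.2 ⟨⟨Z.erase j, h.erase_mem j hj'.2, ?_⟩, ?_⟩
    · rw [h.inter_erase_eq (h.erase_mem j hj'.2), erase_right_comm]
    · rw [card_erase_of_mem hj]
      omega

theorem three_mul_card_sub_six_le {m : ℕ} : ∀ {Z : Finset α} {F : Finset (Finset α)},
    LeaveOneOutFamily Z F → #Z = m + 3 → 3 * m + 3 ≤ #F := by
  induction m with
  | zero =>
    intro Z F h hZ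
    have hinj : Set.InjOn (fun j => Z.erase j) Z := fun a ha b hb hab =>
      (erase_inj Z ha).1 hab
    have hsub : Z.image (fun j => Z.erase j) ⊆ F := by
      intro A hA
      obtain ⟨j, hj, rfl⟩ := mem_image.1 hA
      exact h.erase_mem j hj
    have := card_le_card hsub
    rw [card_image_of_injOn hinj] at this
    omega
  | succ m ih =>
    intro Z F h hZ
    obtain ⟨i, hi⟩ : Z.Nonempty := card_pos.1 (by omega)
    have h1 := ih (h.trace_erase hi (by omega)) (by rw [card_erase_of_mem hi]; omega)
    have h2 := h.card_trace_erase_add_le hi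
    have h3 := h.two_le_card_pointExtensions hi (by omega)
    omega

end LeaveOneOutFamily

/-! ### Families of minimum size: compatibility, complements, unique splitting -/

/-- A leave-one-out family of the smallest possible size. -/
structure OptimalFamily (Z : Finset α) (F : Finset (Finset α)) : Prop
    extends LeaveOneOutFamily Z F where
  three_le : 3 ≤ #Z
  card_eq : #F + 6 = 3 * #Z

namespace OptimalFamily

variable {Z : Finset α} {F : Finset (Finset α)}

/-- The inductive step of the size bound has no slack here, so both of its inequalities are
equalities. -/
lemma trace_erase_and_card (h : OptimalFamily Z F) {i : α} (hi : i ∈ Z) (hZ : 4 ≤ #Z) :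
    OptimalFamily (Z.erase i) (trace (Z.erase i) F) ∧ #(pointExtensions F i) = 2 := by
  have h0 := h.toLeaveOneOutFamily.trace_erase hi hZ
  have hc := card_erase_of_mem hi
  have h1 := h0.three_mul_card_sub_six_le (m := #Z - 4) (by omega)
  have h2 := h.toLeaveOneOutFamily.card_trace_erase_add_le hi
  have h3 := h.toLeaveOneOutFamily.two_le_card_pointExtensions hi (by omega)
  have h4 := h.card_eq
  exact ⟨⟨h0, by omega, by omega⟩, by omega⟩

lemma trace_self (h : LeaveOneOutFamily Z F) : trace Z F = F := by
  ext A
  rw [mem_trace]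
  constructor
  · rintro ⟨⟨B, hB, rfl⟩, -⟩
    rwa [inter_eq_left.2 (h.subset B hB)]
  · intro hA
    exact ⟨⟨A, hA, inter_eq_left.2 (h.subset A hA)⟩, h.two_le A hA, h.card_lt A hA⟩

lemma trace_trace {Y Z : Finset α} (hYZ : Y ⊆ Z) (F : Finset (Finset α)) :
    trace Y (trace Z F) = trace Y F := by
  ext A
  simp only [mem_trace]
  constructor
  · rintro ⟨⟨B, ⟨⟨C, hC, rfl⟩, -⟩, rfl⟩, h2⟩
    refine ⟨⟨C, hC, ?_⟩, h2⟩
    rw [inter_assoc, inter_eq_right.2 hYZ]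
  · rintro ⟨⟨C, hC, rfl⟩, h2, hlt⟩
    refine ⟨⟨C ∩ Z, ⟨⟨C, hC, rfl⟩, ?_, ?_⟩, ?_⟩, h2, hlt⟩
    · exact h2.trans (card_le_card (inter_subset_inter_left hYZ))
    · refine card_lt_card ⟨inter_subset_right, fun hs => ?_⟩
      have : C ∩ Y = Y := inter_eq_right.2 ((hYZ.trans hs).trans inter_subset_left)
      rw [this] at hlt
      omega
    · rw [inter_assoc, inter_eq_right.2 hYZ]

/-- Optimality is hereditary, which lets later arguments restrict to well-chosen subsets, often of
four points. -/
lemma trace_subset : ∀ (k : ℕ) {Y Z : Finset α} {F : Finset (Finset α)}, OptimalFamily Z F →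
    Y ⊆ Z → 3 ≤ #Y → #(Z \ Y) = k → OptimalFamily Y (trace Y F) := by
  intro k
  induction k with
  | zero =>
    intro Y Z F h hYZ hY hk
    obtain rfl : Y = Z := subset_antisymm hYZ (sdiff_eq_empty_iff_subset.1 (card_eq_zero.1 hk))
    rwa [trace_self h.toLeaveOneOutFamily]
  | succ k ih =>
    intro Y Z F h hYZ hY hk
    obtain ⟨i, hi⟩ : (Z \ Y).Nonempty := card_pos.1 (by omega)
    obtain ⟨hiZ, hiY⟩ := mem_sdiff.1 hi
    have hsub : Y ⊆ Z.erase i := subset_erase.2 ⟨hYZ, hiY⟩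
    have hcard := card_le_card hsub
    rw [card_erase_of_mem hiZ] at hcard
    have h' := (h.trace_erase_and_card hiZ (by omega)).1
    rw [← trace_trace hsub]
    refine ih h' hsub hY ?_
    rw [erase_sdiff_comm, card_erase_of_mem hi, hk]
    rfl

/-- An optimal family on four points has six members, four of them triples, so only two pairs. The
triple avoiding `a` splits off a pair avoiding `a`, which leaves room for only one pair through `a`.
-/
lemma pair_notMem (h : OptimalFamily Z F) {a b c d : α} (hZ : Z = {a, b, c, d})
    (hab : a ≠ b) (hac : a ≠ c) (had : a ≠ d) (hbc : b ≠ c) (hbd : b ≠ d) (hcd : c ≠ d)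
    (hF : {a, b} ∈ F) : {a, c} ∉ F := by
  intro hF'
  subst hZ
  have hZ4 : #({a, b, c, d} : Finset α) = 4 := by simp [*]
  have hmem : ({a, b, c, d} : Finset α).erase a ∈ F := h.erase_mem a (by simp)
  have e3 : #(({a, b, c, d} : Finset α).erase a) = 3 := by
    rw [card_erase_of_mem (by simp), hZ4]
  have haE : a ∉ ({a, b, c, d} : Finset α).erase a := by simp
  obtain ⟨P, hPF, haP, hP2⟩ : ∃ P ∈ F, a ∉ P ∧ #P = 2 := by
    obtain ⟨B, C, hd, hu, hB, hC⟩ := h.split _ hmem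
    have hcard : #B + #C = 3 := by rw [← card_union_of_disjoint hd, hu, e3]
    have hBpos := card_pos.2 (h.memOrUnit_nonempty hB)
    have hCpos := card_pos.2 (h.memOrUnit_nonempty hC)
    rw [← hu, mem_union, not_or] at haE
    rcases hB with hB | hB
    · by_cases h2 : #B = 2
      · exact ⟨B, hB, haE.1, h2⟩
      · have := h.two_le B hB
        omega
    · exact ⟨C, LeaveOneOutFamily.mem_of_memOrUnit hC (by omega), haE.2, by omega⟩
  have hinj : Set.InjOn (fun j => ({a, b, c, d} : Finset α).erase j) ({a, b, c, d} : Finset α) :=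
    fun x hx y hy hxy => (erase_inj _ hx).1 hxy
  have hI := card_image_of_injOn hinj
  rw [hZ4] at hI
  set I := ({a, b, c, d} : Finset α).image (fun j => ({a, b, c, d} : Finset α).erase j) with hIdef
  have hI3 : ∀ A ∈ I, #A = 3 := by
    intro A hA
    obtain ⟨j, hj, rfl⟩ := mem_image.1 hA
    rw [card_erase_of_mem hj, hZ4]
  have hIF : I ⊆ F := by
    intro A hA
    obtain ⟨j, hj, rfl⟩ := mem_image.1 hA
    exact h.erase_mem j hj
  have hJ : #({{a, b}, {a, c}, P} : Finset (Finset α)) = 3 := by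
    have h1 : ({a, b} : Finset α) ≠ {a, c} := fun e => by
      have : b ∈ ({a, c} : Finset α) := e ▸ (by simp)
      simp only [mem_insert, mem_singleton] at this
      rcases this with e | e
      · exact hab e.symm
      · exact hbc e
    have h2 : ({a, b} : Finset α) ≠ P := fun e => haP (e ▸ by simp)
    have h3 : ({a, c} : Finset α) ≠ P := fun e => haP (e ▸ by simp)
    rw [card_eq_three]
    exact ⟨_, _, _, h1, h2, h3, rfl⟩
  have hJ2 : ∀ A ∈ ({{a, b}, {a, c}, P} : Finset (Finset α)), #A = 2 := by
    simp [hab, hac, hP2]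
  have hJF : ({{a, b}, {a, c}, P} : Finset (Finset α)) ⊆ F := by
    intro A hA
    simp only [mem_insert, mem_singleton] at hA
    rcases hA with rfl | rfl | rfl <;> assumption
  have hdisj : Disjoint I ({{a, b}, {a, c}, P} : Finset (Finset α)) := by
    rw [disjoint_left]
    intro A hA hA'
    have := hI3 A hA
    have := hJ2 A hA'
    omega
  have := card_le_card (union_subset hIF hJF)
  rw [card_union_of_disjoint hdisj, hI, hJ] at this
  have := h.card_eq
  omega

/-- Any two members of an optimal family are compatible as splits of `Z`. -/
theorem compatible (h : OptimalFamily Z F) {A B : Finset α} (hA : A ∈ F) (hB : B ∈ F)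
    {a b c d : α} (haA : a ∈ A) (haB : a ∈ B) (hbA : b ∈ A) (hbB : b ∉ B) (hcA : c ∉ A)
    (hcB : c ∈ B) (hdZ : d ∈ Z) (hdA : d ∉ A) (hdB : d ∉ B) : False := by
  have hab : a ≠ b := by rintro rfl; exact hbB haB
  have hac : a ≠ c := by rintro rfl; exact hcA haA
  have had : a ≠ d := by rintro rfl; exact hdA haA
  have hbc : b ≠ c := by rintro rfl; exact hcA hbA
  have hbd : b ≠ d := by rintro rfl; exact hdA hbA
  have hcd : c ≠ d := by rintro rfl; exact hdB hcB
  have hYZ : ({a, b, c, d} : Finset α) ⊆ Z := by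
    intro x hx
    simp only [mem_insert, mem_singleton] at hx
    rcases hx with rfl | rfl | rfl | rfl
    · exact h.subset A hA haA
    · exact h.subset A hA hbA
    · exact h.subset B hB hcB
    · exact hdZ
  have h4 : #({a, b, c, d} : Finset α) = 4 := by simp [*]
  have hopt := trace_subset _ h hYZ (by omega) rfl
  have eA : A ∩ {a, b, c, d} = {a, b} := by
    ext x
    simp only [mem_inter, mem_insert, mem_singleton]
    constructor
    · rintro ⟨hx, rfl | rfl | rfl | rfl⟩ <;> simp_all
    · rintro (rfl | rfl) <;> simp_all
  have eB : B ∩ {a, b, c, d} = {a, c} := by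
    ext x
    simp only [mem_inter, mem_insert, mem_singleton]
    constructor
    · rintro ⟨hx, rfl | rfl | rfl | rfl⟩ <;> simp_all
    · rintro (rfl | rfl) <;> simp_all
  refine hopt.pair_notMem rfl hab hac had hbc hbd hcd (mem_trace.2 ⟨⟨A, hA, eA⟩, ?_, ?_⟩)
    (mem_trace.2 ⟨⟨B, hB, eB⟩, ?_, ?_⟩)
  all_goals rw [card_pair (by assumption)]
  all_goals omega

/-- For `#Z ≥ 4` there are exactly two point extensions `A`, `B` of `i`. Each `k ≠ i` in `Z` is
avoided by one of them, so they meet only in `i`; by compatibility they cover `Z`. Thus `Z \ A =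
B.erase i`. -/
lemma sdiff_memOrUnit_of_pointExtension (h : OptimalFamily Z F) {i : α} {A : Finset α}
    (hA : A ∈ pointExtensions F i) : MemOrUnit F (Z \ A) := by
  obtain ⟨hAF, hiA, hAi⟩ := mem_filter.1 hA
  have hAZ := h.subset A hAF
  have hlt := h.card_lt A hAF
  have h2 := h.two_le A hAF
  by_cases hZ : #Z = 3
  · right
    rw [card_sdiff_of_subset hAZ]
    omega
  have h3 := h.three_le
  have hK := (h.trace_erase_and_card (hAZ hiA) (by omega)).2
  obtain ⟨j, hjA, hji⟩ := exists_mem_ne (by omega : 1 < #A) i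
  obtain ⟨B, hB, hjB⟩ :=
    h.exists_pointExtension_notMem (hAZ hiA) (hAZ hjA) hji.symm
  obtain ⟨hBF, hiB, hBi⟩ := mem_filter.1 hB
  have hABne : A ≠ B := fun e => hjB (e ▸ hjA)
  have honly : ∀ C ∈ pointExtensions F i, C = A ∨ C = B := by
    have : ({A, B} : Finset (Finset α)) = pointExtensions F i := by
      refine eq_of_subset_of_card_le ?_ ?_
      · intro C hC
        simp only [mem_insert, mem_singleton] at hC
        rcases hC with rfl | rfl <;> assumption
      · rw [hK, card_pair hABne]
    intro C hC
    rw [← this] at hC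
    simpa using hC
  have hdisj : ∀ k ∈ A, k ≠ i → k ∉ B := by
    intro k hkA hki hkB
    obtain ⟨C, hC, hkC⟩ := h.exists_pointExtension_notMem (hAZ hiA) (hAZ hkA) hki.symm
    rcases honly C hC with rfl | rfl <;> contradiction
  have hcov : ∀ k ∈ Z, k ∉ A → k ∈ B := by
    intro k hkZ hkA
    by_contra hkB
    obtain ⟨c, hcB, hci⟩ := exists_mem_ne (by have := h.two_le B hBF; omega : 1 < #B) i
    exact h.compatible hAF hBF hiA hiB hjA hjB (fun hcA => hdisj c hcA hci hcB) hcB hkZ hkA hkB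
  have : Z \ A = B.erase i := by
    ext k
    simp only [mem_sdiff, mem_erase]
    constructor
    · rintro ⟨hkZ, hkA⟩
      exact ⟨fun e => hkA (e ▸ hiA), hcov k hkZ hkA⟩
    · rintro ⟨hki, hkB⟩
      exact ⟨h.subset B hBF hkB, fun hkA => hdisj k hkA hki hkB⟩
  rw [this]
  exact hBi

/-- An optimal family is closed under complements, up to singletons. -/
theorem sdiff_memOrUnit (h : OptimalFamily Z F) {A : Finset α} (hA : A ∈ F) :
    MemOrUnit F (Z \ A) := by
  obtain ⟨B, C, hd, hu, hB, hC⟩ := h.split A hA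
  have hAZ := h.subset A hA
  have hlt := h.card_lt A hA
  have hBA : B ⊆ A := hu ▸ subset_union_left
  have hCA : C ⊆ A := hu ▸ subset_union_right
  obtain ⟨b, hb⟩ := h.memOrUnit_nonempty hB
  obtain ⟨c, hc⟩ := h.memOrUnit_nonempty hC
  have hbC : b ∉ C := disjoint_left.1 hd hb
  obtain ⟨e, heZ, heA⟩ : ∃ e ∈ Z, e ∉ A := by
    by_contra! hcon
    exact absurd (card_le_card hcon) (by omega)
  -- Shrinking the part `B` to the single point `b` turns `A` into a point extension of `b` with the
  -- same complement.
  set Y : Finset α := insert b (Z \ B) with hY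
  have hYZ : Y ⊆ Z := insert_subset (hAZ (hBA hb)) sdiff_subset
  have hYA : Y \ A = Z \ A := by
    ext x
    simp only [hY, mem_sdiff, mem_insert]
    constructor
    · rintro ⟨rfl | hx, hxA⟩
      · exact absurd (hBA hb) hxA
      · exact ⟨hx.1, hxA⟩
    · rintro ⟨hx, hxA⟩
      exact ⟨Or.inr ⟨hx, fun hxB => hxA (hBA hxB)⟩, hxA⟩
  have hAY : A ∩ Y = insert b C := by
    ext x
    have : x ∈ A ↔ x ∈ B ∨ x ∈ C := by rw [← hu, mem_union]
    have hdx : x ∈ B → x ∉ C := fun hx => disjoint_left.1 hd hx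
    simp only [hY, mem_inter, mem_sdiff, mem_insert]
    constructor
    · rintro ⟨hxA, rfl | hx⟩
      · exact Or.inl rfl
      · tauto
    · rintro (rfl | hx)
      · exact ⟨hBA hb, Or.inl rfl⟩
      · exact ⟨hCA hx, Or.inr ⟨hAZ (hCA hx), fun hxB => hdx hxB hx⟩⟩
  have hAeq : Y \ (insert b C) = Z \ A := by
    rw [← hAY, sdiff_inter_self_right, hYA]
  have hcb : c ≠ b := fun e => hbC (e ▸ hc)
  have heY : e ∈ Y := mem_insert_of_mem (mem_sdiff.2 ⟨heZ, fun he => heA (hBA he)⟩)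
  have hcY : c ∈ Y :=
    mem_insert_of_mem (mem_sdiff.2 ⟨hAZ (hCA hc), fun hcB => disjoint_left.1 hd hcB hc⟩)
  have hY3 : 3 ≤ #Y := by
    have hs : ({b, c, e} : Finset α) ⊆ Y := by
      intro x hx
      simp only [mem_insert, mem_singleton] at hx
      rcases hx with rfl | rfl | rfl
      · exact mem_insert_self _ _
      · exact hcY
      · exact heY
    have : #({b, c, e} : Finset α) = 3 := card_eq_three.2
      ⟨b, c, e, hcb.symm, fun h' => heA (h' ▸ hBA hb), fun h' => heA (h' ▸ hCA hc), rfl⟩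
    exact this ▸ card_le_card hs
  have hopt := trace_subset _ h hYZ hY3 rfl
  have hbCY : insert b C ⊆ Y := hAY ▸ inter_subset_right
  have hCpos := card_pos.2 ⟨c, hc⟩
  have hltY : #(insert b C) < #Y := card_lt_card ⟨hbCY, fun hs => heA (by
    have := hs heY
    rw [← hAY] at this
    exact (mem_inter.1 this).1)⟩
  have hci : #(insert b C) = #C + 1 := card_insert_of_notMem hbC
  have hmem : insert b C ∈ pointExtensions (trace Y F) b := by
    refine mem_filter.2 ⟨mem_trace.2 ⟨⟨A, hA, hAY⟩, by omega, hltY⟩, mem_insert_self _ _, ?_⟩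
    rw [erase_insert hbC]
    by_cases h1 : #C = 1
    · exact Or.inr h1
    · refine Or.inl (mem_trace.2 ⟨⟨C, LeaveOneOutFamily.mem_of_memOrUnit hC (by omega), ?_⟩,
        by omega, by omega⟩)
      exact inter_eq_left.2 ((subset_insert b C).trans hbCY)
  have hres := hopt.sdiff_memOrUnit_of_pointExtension hmem
  rw [hAeq] at hres
  rcases hres with hres | hres
  swap
  · exact Or.inr hres
  obtain ⟨⟨D, hD, hDY⟩, -⟩ := mem_trace.1 hres
  have hbY : b ∈ Y := mem_insert_self _ _
  have hD_iff : ∀ x ∈ Y, x ∈ D ↔ x ∉ A := by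
    intro x hx
    have hxZ := hYZ hx
    have : x ∈ D ∩ Y ↔ x ∈ Z \ A := by rw [hDY]
    simp only [mem_inter, mem_sdiff, hx, hxZ, and_true, true_and] at this
    exact this
  -- The complement is only known to be the trace of a member `D` on `Y`. If `D` met `B`, the two
  -- would cross, with `c` outside both; otherwise `D` lies inside `Y` and is the complement itself.
  by_cases hDB : ∃ x ∈ D, x ∈ B
  · exfalso
    obtain ⟨x, hxD, hxB⟩ := hDB
    have hbD : b ∉ D := fun hbD => (hD_iff b hbY).1 hbD (hBA hb)
    have hcD : c ∉ D := fun hcD => (hD_iff c hcY).1 hcD (hCA hc)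
    have heD : e ∈ D := (hD_iff e heY).2 heA
    have hBF : B ∈ F := by
      rcases hB with hB | hB
      · exact hB
      · obtain ⟨z, rfl⟩ := card_eq_one.1 hB
        simp only [mem_singleton] at hb hxB
        exact absurd (hxB.trans hb.symm ▸ hxD) hbD
    exact h.compatible hBF hD hxB hxD hb hbD (fun heB => heA (hBA heB)) heD (hAZ (hCA hc))
      (fun hcB => disjoint_left.1 hd hcB hc) hcD
  · left
    push Not at hDB
    have : D = Z \ A := by
      rw [← hDY]
      refine (inter_eq_left.2 fun x hx => ?_).symm
      exact mem_insert_of_mem (mem_sdiff.2 ⟨h.subset D hD hx, hDB x hx⟩)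
    exact this ▸ hD

/-- Members of an optimal family split in only one way. -/
theorem split_unique (h : OptimalFamily Z F) {A B C D E : Finset α} (hA : A ∈ F)
    (hB : MemOrUnit F B) (hC : MemOrUnit F C) (hD : MemOrUnit F D) (hE : MemOrUnit F E)
    (hBC : Disjoint B C) (hDE : Disjoint D E) (hBCA : B ∪ C = A) (hDEA : D ∪ E = A) :
    B = D ∨ C = D := by
  obtain ⟨z, hzZ, hzA⟩ : ∃ z ∈ Z, z ∉ A := by
    by_contra! hcon
    exact absurd (card_le_card hcon) (by have := h.card_lt A hA; omega)
  -- All subsets of `A` miss `z`, so compatibility makes the members inside `A` laminar: nested or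
  -- disjoint.
  have hcross : ∀ P Q, MemOrUnit F P → MemOrUnit F Q → P ⊆ A → Q ⊆ A →
      ∀ x, x ∈ P → x ∈ Q → (∃ y ∈ P, y ∉ Q) → (∃ y ∈ Q, y ∉ P) → False := by
    rintro P Q hP hQ hPA hQA x hxP hxQ ⟨p, hpP, hpQ⟩ ⟨q, hqQ, hqP⟩
    have hPF : P ∈ F := LeaveOneOutFamily.mem_of_memOrUnit hP
      (one_lt_card.2 ⟨x, hxP, p, hpP, fun e => hpQ (e ▸ hxQ)⟩)
    have hQF : Q ∈ F := LeaveOneOutFamily.mem_of_memOrUnit hQ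
      (one_lt_card.2 ⟨x, hxQ, q, hqQ, fun e => hqP (e ▸ hxP)⟩)
    exact h.compatible hPF hQF hxP hxQ hpP hpQ hqP hqQ hzZ (fun hz => hzA (hPA hz))
      (fun hz => hzA (hQA hz))
  have hBA : B ⊆ A := hBCA ▸ subset_union_left
  have hCA : C ⊆ A := hBCA ▸ subset_union_right
  have hDA : D ⊆ A := hDEA ▸ subset_union_left
  have hEA : E ⊆ A := hDEA ▸ subset_union_right
  have hA1 : ∀ x ∈ A, x ∈ B ∨ x ∈ C := fun x hx => by rwa [← hBCA, mem_union] at hx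
  have hA2 : ∀ x ∈ A, x ∈ D ∨ x ∈ E := fun x hx => by rwa [← hDEA, mem_union] at hx
  have dBC : ∀ x, x ∈ B → x ∉ C := fun x hx => disjoint_left.1 hBC hx
  have dDE : ∀ x, x ∈ D → x ∉ E := fun x hx => disjoint_left.1 hDE hx
  by_contra! hne
  obtain ⟨hBD, hCD⟩ := hne
  -- If `A = P ⊔ Q = R ⊔ S` with `R` strictly inside `P`, then `P` and `S` cross: they meet in `P \
  -- R`, while `R` lies in `P` only and `Q` in `S` only.
  have key : ∀ P Q R S : Finset α, MemOrUnit F P → MemOrUnit F S → P ⊆ A → S ⊆ A →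
      (∀ x ∈ A, x ∈ R ∨ x ∈ S) → (∀ x, x ∈ R → x ∉ S) →
      Q.Nonempty → R.Nonempty → (∀ x, x ∈ P → x ∉ Q) → Q ⊆ A →
      R ⊆ A → R ⊆ P → R ≠ P → False := by
    intro P Q R S hP hS hPA hSA hRS dRS hQ hR dPQ hQA hRA hRP hne'
    obtain ⟨x, hxP, hxR⟩ : ∃ x ∈ P, x ∉ R := by
      by_contra! hcon
      exact hne' (subset_antisymm hRP hcon)
    obtain ⟨q, hq⟩ := hQ
    obtain ⟨r, hr⟩ := hR
    refine hcross P S hP hS hPA hSA x hxP ((hRS x (hPA hxP)).resolve_left hxR)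
      ⟨r, hRP hr, dRS r hr⟩ ⟨q, (hRS q (hQA hq)).resolve_left fun hqR => dPQ q (hRP hqR) hq,
        fun hqP => dPQ q hqP hq⟩
  have nB := h.memOrUnit_nonempty hB
  have nC := h.memOrUnit_nonempty hC
  have nD := h.memOrUnit_nonempty hD
  have nE := h.memOrUnit_nonempty hE
  by_cases hmeet : ∃ x ∈ B, x ∈ D
  · obtain ⟨x, hxB, hxD⟩ := hmeet
    by_cases h1 : D ⊆ B
    · exact key B C D E hB hE hBA hEA hA2 dDE nC nD dBC hCA hDA h1 (Ne.symm hBD)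
    by_cases h2 : B ⊆ D
    · exact key D E B C hD hC hDA hCA hA1 dBC nE nB dDE hEA hBA h2 hBD
    obtain ⟨p, hp, hp'⟩ := not_subset.1 h1
    obtain ⟨q, hq, hq'⟩ := not_subset.1 h2
    exact hcross B D hB hD hBA hDA x hxB hxD ⟨q, hq, hq'⟩ ⟨p, hp, hp'⟩
  · push Not at hmeet
    have hDC : D ⊆ C := fun x hx => (hA1 x (hDA hx)).resolve_left fun hxB => hmeet x hxB hx
    exact key C B D E hC hE hCA hEA hA2 dDE nB nD (fun x hxC hxB => dBC x hxB hxC) hBA hDA hDC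
      (Ne.symm hCD)

end OptimalFamily

end SetFamilies

/-! ### From structures to set families -/

/-- The conditions on a structure computing all leave-one-out combinations, except that different
nodes may have the same subtree. -/
structure IsLeaveOneOut {V : Type} {n : ℕ} (G : Digraph V) (x y : Fin n ↪ V) : Prop where
  acyclic : IsAcyclic G
  mem_inputs_iff : ∀ a : V, a ∈ Set.range x ↔ ∀ b : V, ¬ G.Adj b a
  entering_isDBT : ∀ a : V, IsDBT (entering G a) ⟨a, Relation.ReflTransGen.refl⟩
  outputs : {a : V | a ∉ Set.range x ∧ ∀ b : V, ¬ G.Adj a b} = Set.range y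
  leaves_y : ∀ j : Fin n, Subtype.val '' leaves (entering G (y j)) = Set.range x \ {x j}

open scoped Classical in
/-- The indices of the inputs from which `a` is reachable. -/
noncomputable def inputsOf {V : Type} {n : ℕ} (G : Digraph V) (x : Fin n ↪ V) (a : V) :
    Finset (Fin n) :=
  univ.filter fun i => Reach G (x i) a

lemma mem_inputsOf {V : Type} {n : ℕ} {G : Digraph V} {x : Fin n ↪ V} {a : V} {i : Fin n} :
    i ∈ inputsOf G x a ↔ Reach G (x i) a := by
  simp [inputsOf]

lemma inputsOf_mono {V : Type} {n : ℕ} {G : Digraph V} {x : Fin n ↪ V} {a b : V}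
    (h : Reach G a b) : inputsOf G x a ⊆ inputsOf G x b := fun _ hi =>
  mem_inputsOf.2 ((mem_inputsOf.1 hi).trans h)

lemma IsAcyclic.wellFounded {V : Type} [Finite V] {G : Digraph V} (h : IsAcyclic G) :
    WellFounded G.Adj := by
  have : Std.Irrefl (Relation.TransGen G.Adj) := ⟨h⟩
  exact Subrelation.wf (fun h => Relation.TransGen.single h)
    (Finite.wellFounded_of_trans_of_irrefl (Relation.TransGen G.Adj))

lemma IsAcyclic.wellFounded_swap {V : Type} [Finite V] {G : Digraph V} (h : IsAcyclic G) :
    WellFounded (Function.swap G.Adj) := by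
  have : Std.Irrefl (Relation.TransGen (Function.swap G.Adj)) :=
    ⟨fun a ha => h a (Relation.transGen_swap.1 ha)⟩
  exact Subrelation.wf (fun h => Relation.TransGen.single h)
    (Finite.wellFounded_of_trans_of_irrefl (Relation.TransGen (Function.swap G.Adj)))

namespace IsLeaveOneOut

variable {V : Type} {n : ℕ} {G : Digraph V} {x y : Fin n ↪ V}

lemma not_adj_of_reach (h : IsLeaveOneOut G x y) {a b : V} (hab : Reach G a b) : ¬ G.Adj b a :=
  fun hba => h.acyclic b (Relation.TransGen.head' hba hab)

/-- A node may have many outgoing edges, but only one of them can lead towards a given `r`, because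
`E(r, G)` is a tree. -/
lemma parent_unique (h : IsLeaveOneOut G x y) {v p q r : V} (hp : G.Adj v p) (hq : G.Adj v q)
    (hpr : Reach G p r) (hqr : Reach G q r) : p = q := by
  have hv : Reach G v r := Relation.ReflTransGen.head hp hpr
  have hne : (⟨v, hv⟩ : {b // Reach G b r}) ≠ ⟨r, Relation.ReflTransGen.refl⟩ := by
    intro e
    have e' : v = r := congrArg Subtype.val e
    subst e'
    exact h.not_adj_of_reach hpr hp
  have := ((h.entering_isDBT r).unique_parent _ hne).unique
    (y₁ := ⟨p, hpr⟩) (y₂ := ⟨q, hqr⟩) hp hq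
  exact congrArg Subtype.val this

lemma children (h : IsLeaveOneOut G x y) {a : V} (ha : a ∉ Set.range x) :
    ∃ b c, b ≠ c ∧ ∀ d, G.Adj d a ↔ d = b ∨ d = c := by
  rw [h.mem_inputs_iff] at ha
  push Not at ha
  obtain ⟨e, he⟩ := ha
  have hr : ∀ {d}, G.Adj d a → Reach G d a := fun hd => Relation.ReflTransGen.single hd
  rcases (h.entering_isDBT a).children ⟨a, Relation.ReflTransGen.refl⟩ with h0 | h2
  · exfalso
    have : (⟨e, hr he⟩ : {b // Reach G b a}) ∈
        {c | (entering G a).Adj c ⟨a, Relation.ReflTransGen.refl⟩} := he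
    rw [h0] at this
    exact this
  · obtain ⟨b, c, hbc, hset⟩ := Set.ncard_eq_two.1 h2
    refine ⟨b.1, c.1, fun e => hbc (Subtype.ext e), fun d => ⟨fun hd => ?_, ?_⟩⟩
    · have : (⟨d, hr hd⟩ : {b // Reach G b a}) ∈
        {c | (entering G a).Adj c ⟨a, Relation.ReflTransGen.refl⟩} := hd
      rw [hset] at this
      rcases this with e | e
      · exact Or.inl (congrArg Subtype.val e)
      · exact Or.inr (congrArg Subtype.val e)
    · rintro (rfl | rfl)
      · have : b ∈ {c | (entering G a).Adj c ⟨a, Relation.ReflTransGen.refl⟩} := by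
          rw [hset]; exact Or.inl rfl
        exact this
      · have : c ∈ {c | (entering G a).Adj c ⟨a, Relation.ReflTransGen.refl⟩} := by
          rw [hset]; exact Or.inr rfl
        exact this

/-- Both paths lead on to `a`, so uniqueness of parents makes them agree edge by edge until one
reaches its end; the other would then continue through `a`, making a cycle. -/
lemma not_reach_both (h : IsLeaveOneOut G x y) {a b c : V} (hb : G.Adj b a) (hc : G.Adj c a)
    (hbc : b ≠ c) {v : V} (hvb : Reach G v b) (hvc : Reach G v c) : False := by
  have hba : Reach G b a := Relation.ReflTransGen.single hb
  have hca : Reach G c a := Relation.ReflTransGen.single hc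
  induction hvb using Relation.ReflTransGen.head_induction_on with
  | refl =>
    rcases Relation.ReflTransGen.cases_head hvc with e | ⟨p, hp, hpc⟩
    · exact hbc e
    · have : p = a := h.parent_unique hp hb (hpc.trans hca) Relation.ReflTransGen.refl
      exact h.not_adj_of_reach (this ▸ hpc) hc
  | head hvp hpb ih =>
    rename_i v p
    rcases Relation.ReflTransGen.cases_head hvc with e | ⟨q, hq, hqc⟩
    · subst e
      have : p = a := h.parent_unique hvp hc (hpb.trans hba) Relation.ReflTransGen.refl
      exact h.not_adj_of_reach (this ▸ hpb) hb
    · have : p = q := h.parent_unique hvp hq (hpb.trans hba) (hqc.trans hca)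
      exact ih (this ▸ hqc)

lemma inputsOf_x (h : IsLeaveOneOut G x y) (i : Fin n) : inputsOf G x (x i) = {i} := by
  ext k
  rw [mem_inputsOf, mem_singleton]
  constructor
  · intro hk
    rcases Relation.ReflTransGen.cases_tail hk with e | ⟨b, -, hb⟩
    · exact x.injective e.symm
    · exact absurd hb ((h.mem_inputs_iff (x i)).1 ⟨i, rfl⟩ b)
  · rintro rfl
    exact Relation.ReflTransGen.refl

lemma disjoint_inputsOf (h : IsLeaveOneOut G x y) {a b c : V} (hb : G.Adj b a) (hc : G.Adj c a)
    (hbc : b ≠ c) : Disjoint (inputsOf G x b) (inputsOf G x c) := by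
  rw [disjoint_left]
  intro i hi hi'
  exact h.not_reach_both hb hc hbc (mem_inputsOf.1 hi) (mem_inputsOf.1 hi')

lemma inputsOf_eq_union {a b c : V} (ha : a ∉ Set.range x)
    (hbc : ∀ d, G.Adj d a ↔ d = b ∨ d = c) :
    inputsOf G x b ∪ inputsOf G x c = inputsOf G x a := by
  ext i
  rw [mem_union, mem_inputsOf, mem_inputsOf, mem_inputsOf]
  constructor
  · rintro (hi | hi)
    · exact hi.tail ((hbc b).2 (Or.inl rfl))
    · exact hi.tail ((hbc c).2 (Or.inr rfl))
  · intro hi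
    rcases Relation.ReflTransGen.cases_tail hi with e | ⟨d, hd, hda⟩
    · exact absurd ⟨i, e.symm⟩ ha
    · rcases (hbc d).1 hda with rfl | rfl
      · exact Or.inl hd
      · exact Or.inr hd

lemma y_notMem (h : IsLeaveOneOut G x y) (j : Fin n) : y j ∉ Set.range x := by
  have : y j ∈ {a : V | a ∉ Set.range x ∧ ∀ b : V, ¬ G.Adj a b} := by
    rw [h.outputs]; exact ⟨j, rfl⟩
  exact this.1

lemma inputsOf_y (h : IsLeaveOneOut G x y) (j : Fin n) : inputsOf G x (y j) = univ.erase j := by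
  ext i
  rw [mem_inputsOf, mem_erase]
  have h1 : Reach G (x i) (y j) ↔ x i ∈ Subtype.val '' leaves (entering G (y j)) := by
    constructor
    · intro hr
      exact ⟨⟨x i, hr⟩, fun c hc => (h.mem_inputs_iff (x i)).1 ⟨i, rfl⟩ c.1 hc, rfl⟩
    · rintro ⟨v, -, hv⟩
      exact hv ▸ v.2
  rw [h1, h.leaves_y]
  simp

variable [Finite V]

lemma inputsOf_nonempty (h : IsLeaveOneOut G x y) (a : V) : (inputsOf G x a).Nonempty := by
  induction a using h.acyclic.wellFounded.induction with
  | _ a ih =>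
    by_cases ha : a ∈ Set.range x
    · obtain ⟨i, rfl⟩ := ha
      exact ⟨i, mem_inputsOf.2 Relation.ReflTransGen.refl⟩
    · obtain ⟨b, c, -, hbc⟩ := h.children ha
      have hb := (hbc b).2 (Or.inl rfl)
      exact (ih b hb).mono (inputsOf_mono (Relation.ReflTransGen.single hb))

lemma two_le_card_inputsOf (h : IsLeaveOneOut G x y) {a : V} (ha : a ∉ Set.range x) :
    2 ≤ #(inputsOf G x a) := by
  obtain ⟨b, c, hne, hbc⟩ := h.children ha
  rw [← inputsOf_eq_union ha hbc, card_union_of_disjoint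
    (h.disjoint_inputsOf ((hbc b).2 (Or.inl rfl)) ((hbc c).2 (Or.inr rfl)) hne)]
  have := card_pos.2 (h.inputsOf_nonempty b)
  have := card_pos.2 (h.inputsOf_nonempty c)
  omega

lemma exists_reach_y (h : IsLeaveOneOut G x y) (a : V) (ha : a ∉ Set.range x) :
    ∃ j, Reach G a (y j) := by
  induction a using h.acyclic.wellFounded_swap.induction with
  | _ a ih =>
    by_cases hs : ∀ b, ¬ G.Adj a b
    · have : a ∈ Set.range y := by rw [← h.outputs]; exact ⟨ha, hs⟩
      obtain ⟨j, rfl⟩ := this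
      exact ⟨j, Relation.ReflTransGen.refl⟩
    · push Not at hs
      obtain ⟨b, hb⟩ := hs
      obtain ⟨j, hj⟩ := ih b hb fun hbx => (h.mem_inputs_iff b).1 hbx a hb
      exact ⟨j, Relation.ReflTransGen.head hb hj⟩

/-- Every computation node reaches some `y j`, whose inputs omit `j`. -/
lemma card_inputsOf_lt (h : IsLeaveOneOut G x y) {a : V} (ha : a ∉ Set.range x) :
    #(inputsOf G x a) < n := by
  obtain ⟨j, hj⟩ := h.exists_reach_y a ha
  have h1 := card_le_card (inputsOf_mono (x := x) hj)
  rw [h.inputsOf_y, card_erase_of_mem (mem_univ j), card_univ, Fintype.card_fin] at h1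
  have := j.2
  omega

/-- The computation nodes. -/
noncomputable def computationNodes (x : Fin n ↪ V) : Finset V :=
  (Set.toFinite {a : V | a ∉ Set.range x}).toFinset

lemma mem_computationNodes {a : V} : a ∈ computationNodes x ↔ a ∉ Set.range x := by
  simp [computationNodes]

lemma memOrUnit_inputsOf (h : IsLeaveOneOut G x y) (a : V) :
    MemOrUnit ((computationNodes x).image (inputsOf G x)) (inputsOf G x a) := by
  by_cases ha : a ∈ Set.range x
  · obtain ⟨i, rfl⟩ := ha
    right
    rw [h.inputsOf_x, card_singleton]
  · exact Or.inl (mem_image_of_mem _ (mem_computationNodes.2 ha))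

theorem leaveOneOutFamily (h : IsLeaveOneOut G x y) :
    LeaveOneOutFamily (univ : Finset (Fin n)) ((computationNodes x).image (inputsOf G x)) where
  subset _ _ := subset_univ _
  two_le A hA := by
    obtain ⟨a, ha, rfl⟩ := mem_image.1 hA
    exact h.two_le_card_inputsOf (mem_computationNodes.1 ha)
  card_lt A hA := by
    obtain ⟨a, ha, rfl⟩ := mem_image.1 hA
    simpa using h.card_inputsOf_lt (mem_computationNodes.1 ha)
  split A hA := by
    obtain ⟨a, ha, rfl⟩ := mem_image.1 hA
    obtain ⟨b, c, hne, hbc⟩ := h.children (mem_computationNodes.1 ha)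
    exact ⟨_, _, h.disjoint_inputsOf ((hbc b).2 (Or.inl rfl)) ((hbc c).2 (Or.inr rfl)) hne,
      inputsOf_eq_union (mem_computationNodes.1 ha) hbc, h.memOrUnit_inputsOf b,
      h.memOrUnit_inputsOf c⟩
  erase_mem j _ := by
    rw [← h.inputsOf_y]
    exact mem_image_of_mem _ (mem_computationNodes.2 (h.y_notMem j))

lemma card_image_ge (h : IsLeaveOneOut G x y) (hn : 3 ≤ n) :
    3 * n - 6 ≤ #((computationNodes x).image (inputsOf G x)) := by
  have := h.leaveOneOutFamily.three_mul_card_sub_six_le (m := n - 3) (by simp; omega)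
  omega

theorem card_computationNodes_ge (h : IsLeaveOneOut G x y) (hn : 3 ≤ n) :
    3 * n - 6 ≤ #(computationNodes x) :=
  (h.card_image_ge hn).trans card_image_le

lemma exists_node_of_memOrUnit (h : IsLeaveOneOut G x y) {A : Finset (Fin n)}
    (hA : MemOrUnit ((computationNodes x).image (inputsOf G x)) A) :
    ∃ a, inputsOf G x a = A := by
  rcases hA with hA | hA
  · obtain ⟨a, -, rfl⟩ := mem_image.1 hA
    exact ⟨a, rfl⟩
  · obtain ⟨i, rfl⟩ := card_eq_one.1 hA
    exact ⟨x i, h.inputsOf_x i⟩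

/-! ### Duality in optimal structures -/

section Optimal

variable (h : IsLeaveOneOut G x y) (hn : 3 ≤ n) (hc : #(computationNodes x) ≤ 3 * n - 6)

include h hn hc

/-- The family already needs `3 * n - 6` distinct sets, so no two computation nodes share one;
inputs are told apart from them by having singletons. -/
theorem inputsOf_injective : Function.Injective (inputsOf G x) := by
  have hinj : Set.InjOn (inputsOf G x) (computationNodes x) := by
    rw [← card_image_iff]
    exact le_antisymm card_image_le (hc.trans (h.card_image_ge hn))
  intro a b hab
  by_cases ha : a ∈ Set.range x
  · obtain ⟨i, rfl⟩ := ha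
    by_cases hb : b ∈ Set.range x
    · obtain ⟨j, rfl⟩ := hb
      rw [h.inputsOf_x, h.inputsOf_x, singleton_inj] at hab
      rw [hab]
    · have := h.two_le_card_inputsOf hb
      rw [← hab, h.inputsOf_x, card_singleton] at this
      omega
  · by_cases hb : b ∈ Set.range x
    · obtain ⟨i, rfl⟩ := hb
      have := h.two_le_card_inputsOf ha
      rw [hab, h.inputsOf_x, card_singleton] at this
      omega
    · exact hinj (mem_computationNodes.2 ha) (mem_computationNodes.2 hb) hab

lemma optimalFamily :
    OptimalFamily (univ : Finset (Fin n)) ((computationNodes x).image (inputsOf G x)) where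
  toLeaveOneOutFamily := h.leaveOneOutFamily
  three_le := by simpa using hn
  card_eq := by
    have h1 := h.card_image_ge hn
    have h2 : #((computationNodes x).image (inputsOf G x)) ≤ _ := card_image_le.trans hc
    rw [card_univ, Fintype.card_fin]
    omega

lemma exists_dual (a : V) : ∃ a', inputsOf G x a' = (inputsOf G x a)ᶜ := by
  by_cases ha : a ∈ Set.range x
  · obtain ⟨i, rfl⟩ := ha
    refine ⟨y i, ?_⟩
    rw [h.inputsOf_x, h.inputsOf_y]
    ext k
    simp
  · refine h.exists_node_of_memOrUnit ?_
    rw [compl_eq_univ_sdiff]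
    exact (h.optimalFamily hn hc).sdiff_memOrUnit
      (mem_image_of_mem _ (mem_computationNodes.2 ha))

/-- If `c` is the sibling of `b`, then `a = b ⊔ c` on input sets becomes `b' = a' ⊔ c` on
complements. Since splittings are unique, `a'` must be a child of `b'`. -/
lemma adj_dual {a b a' b' : V} (hba : G.Adj b a) (ha' : inputsOf G x a' = (inputsOf G x a)ᶜ)
    (hb' : inputsOf G x b' = (inputsOf G x b)ᶜ) : G.Adj a' b' := by
  have ha : a ∉ Set.range x := fun hax => (h.mem_inputs_iff a).1 hax b hba
  obtain ⟨c, hcb, hca, hu⟩ : ∃ c, b ≠ c ∧ G.Adj c a ∧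
      inputsOf G x b ∪ inputsOf G x c = inputsOf G x a := by
    obtain ⟨p, q, hpq, hchild⟩ := h.children ha
    have hp := (hchild p).2 (Or.inl rfl)
    have hq := (hchild q).2 (Or.inr rfl)
    have hu := inputsOf_eq_union ha hchild
    rcases (hchild b).1 hba with rfl | rfl
    · exact ⟨q, hpq, hq, hu⟩
    · exact ⟨p, hpq.symm, hp, by rw [union_comm]; exact hu⟩
  have hd := h.disjoint_inputsOf hba hca hcb
  have hd' : Disjoint (inputsOf G x a') (inputsOf G x c) := by
    rw [ha', disjoint_left]
    intro i hi hic
    rw [mem_compl, ← hu, mem_union] at hi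
    exact hi (Or.inr hic)
  have hu' : inputsOf G x a' ∪ inputsOf G x c = inputsOf G x b' := by
    rw [ha', hb', ← hu]
    ext i
    have hnot : i ∈ inputsOf G x b → i ∉ inputsOf G x c := fun hi => disjoint_left.1 hd hi
    simp only [mem_union, mem_compl]
    tauto
  have hb'x : b' ∉ Set.range x := by
    rintro ⟨i, rfl⟩
    have h1 := congrArg card hu'
    rw [h.inputsOf_x, card_union_of_disjoint hd', card_singleton] at h1
    have := card_pos.2 (h.inputsOf_nonempty a')
    have := card_pos.2 (h.inputsOf_nonempty c)
    omega
  obtain ⟨p, q, hpq, hchild⟩ := h.children hb'x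
  have hp := (hchild p).2 (Or.inl rfl)
  have hq := (hchild q).2 (Or.inr rfl)
  rcases (h.optimalFamily hn hc).split_unique
    (mem_image_of_mem _ (mem_computationNodes.2 hb'x)) (h.memOrUnit_inputsOf p)
    (h.memOrUnit_inputsOf q) (h.memOrUnit_inputsOf a') (h.memOrUnit_inputsOf c)
    (h.disjoint_inputsOf hp hq hpq) hd' (inputsOf_eq_union hb'x hchild) hu' with e | e
  · exact h.inputsOf_injective hn hc e ▸ hp
  · exact h.inputsOf_injective hn hc e ▸ hq

end Optimal

end IsLeaveOneOut

/-! ### Directed paths and the latency bound -/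

/-- There is a directed path with `k` edges from `a` to `b`, possibly with repeated nodes. -/
def Steps {V : Type} (G : Digraph V) : ℕ → V → V → Prop
  | 0, a, b => a = b
  | k + 1, a, b => ∃ c, Steps G k a c ∧ G.Adj c b

namespace Steps

variable {V : Type} {G : Digraph V}

lemma trans {k l : ℕ} {a b c : V} (h : Steps G k a b) (h' : Steps G l b c) :
    Steps G (k + l) a c := by
  induction l generalizing c with
  | zero => exact (show b = c from h') ▸ h
  | succ l ih =>
    obtain ⟨d, hd, hdc⟩ := h'
    exact ⟨d, ih hd, hdc⟩

lemma single {a b : V} (h : G.Adj a b) : Steps G 1 a b := ⟨a, rfl, h⟩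

lemma of_path {k : ℕ} {v : Fin (k + 1) → V} (hv : ∀ i : Fin k, G.Adj (v i.castSucc) (v i.succ))
    {i j : ℕ} (hij : i + j ≤ k) :
    Steps G j (v ⟨i, by omega⟩) (v ⟨i + j, by omega⟩) := by
  induction j with
  | zero => exact rfl
  | succ j ih => exact ⟨_, ih (by omega), hv ⟨i + j, by omega⟩⟩

lemma exists_path {k : ℕ} {a b : V} (h : Steps G k a b) :
    ∃ v : Fin (k + 1) → V, v (Fin.last k) = b ∧
      ∀ i : Fin k, G.Adj (v i.castSucc) (v i.succ) := by
  induction k generalizing b with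
  | zero => exact ⟨fun _ => b, rfl, fun i => i.elim0⟩
  | succ k ih =>
    obtain ⟨c, hc, hcb⟩ := h
    obtain ⟨v, hvc, hv⟩ := ih hc
    refine ⟨Fin.snoc v b, by simp, fun i => ?_⟩
    induction i using Fin.lastCases with
    | last =>
      rw [Fin.succ_last, Fin.snoc_last, Fin.snoc_castSucc, hvc]
      exact hcb
    | cast i =>
      rw [Fin.succ_castSucc, Fin.snoc_castSucc, Fin.snoc_castSucc]
      exact hv i

lemma transGen {k : ℕ} {a b : V} (h : Steps G (k + 1) a b) : Relation.TransGen G.Adj a b := by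
  induction k generalizing b with
  | zero =>
    obtain ⟨c, rfl, hcb⟩ := h
    exact Relation.TransGen.single hcb
  | succ k ih =>
    obtain ⟨c, hc, hcb⟩ := h
    exact (ih hc).tail hcb

end Steps

lemma IsAcyclic.hasSimplePath {V : Type} {G : Digraph V} (hG : IsAcyclic G) {k : ℕ} {a b : V}
    (h : Steps G k a b) : HasSimplePath G k := by
  obtain ⟨v, -, hv⟩ := h.exists_path
  refine ⟨v, ?_, hv⟩
  have key : ∀ i j : Fin (k + 1), i < j → v i ≠ v j := by
    intro i j hij e
    obtain ⟨d, hd⟩ := Nat.exists_eq_add_of_lt hij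
    have := Steps.of_path hv (i := i) (j := d + 1) (by omega)
    have e' : (⟨(i : ℕ) + (d + 1), by omega⟩ : Fin (k + 1)) = j := Fin.ext (by simp; omega)
    rw [e', Fin.eta, e] at this
    exact hG _ this.transGen
  intro i j e
  rcases lt_trichotomy i j with hij | hij | hij
  · exact absurd e (key i j hij)
  · exact hij
  · exact absurd e.symm (key j i hij)

namespace IsLeaveOneOut

variable {V : Type} {n : ℕ} {G : Digraph V} {x y : Fin n ↪ V}

lemma card_inputsOf_le_two_pow (h : IsLeaveOneOut G x y) {p : ℕ} {a : V}
    (hp : ∀ k z, Steps G k z a → k ≤ p) : #(inputsOf G x a) ≤ 2 ^ p := by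
  induction p generalizing a with
  | zero =>
    have ha : a ∈ Set.range x := by
      rw [h.mem_inputs_iff]
      intro b hb
      have := hp 1 b (Steps.single hb)
      omega
    obtain ⟨i, rfl⟩ := ha
    rw [h.inputsOf_x, card_singleton, pow_zero]
  | succ p ih =>
    by_cases ha : a ∈ Set.range x
    · obtain ⟨i, rfl⟩ := ha
      rw [h.inputsOf_x, card_singleton]
      exact Nat.one_le_two_pow
    · obtain ⟨b, c, hne, hbc⟩ := h.children ha
      have hchild : ∀ d, G.Adj d a → #(inputsOf G x d) ≤ 2 ^ p := fun d hd =>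
        ih fun k z hz => by
          have := hp (k + 1) z ⟨d, hz, hd⟩
          omega
      rw [← inputsOf_eq_union ha hbc]
      have h1 := hchild b ((hbc b).2 (Or.inl rfl))
      have h2 := hchild c ((hbc c).2 (Or.inr rfl))
      have h3 := card_union_le (inputsOf G x b) (inputsOf G x c)
      rw [pow_succ]
      omega

/-- In an optimal structure the number of inputs is bounded in terms of the longest path. -/
theorem card_le_two_pow_add_two_pow [Finite V] (h : IsLeaveOneOut G x y) (hn : 3 ≤ n)
    (hc : #(computationNodes x) ≤ 3 * n - 6) {l m : ℕ} (hml : m ≤ l) (hl : HasSimplePath G l)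
    (hmax : ∀ k, HasSimplePath G k → k ≤ l) : n ≤ 2 ^ m + 2 ^ (l - m) := by
  obtain ⟨v, -, hv⟩ := hl
  have h1 := Steps.of_path hv (i := 0) (j := m) (by omega)
  have h2 := Steps.of_path hv (i := 0 + m) (j := l - m) (by omega)
  set a := v ⟨0 + m, by omega⟩
  obtain ⟨a', ha'⟩ := h.exists_dual hn hc a
  -- Duality reverses paths: one into the dual of `b` becomes one of equal length out of `b`.
  have hrev : ∀ (k : ℕ) (z b b' : V), inputsOf G x b' = (inputsOf G x b)ᶜ → Steps G k z b' →
      ∃ z', Steps G k b z' ∧ inputsOf G x z = (inputsOf G x z')ᶜ := by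
    intro k
    induction k with
    | zero =>
      rintro z b b' hb' rfl
      exact ⟨b, rfl, hb'⟩
    | succ k ih =>
      rintro z b b' hb' ⟨c', hc', hadj⟩
      obtain ⟨c, hcc⟩ := h.exists_dual hn hc c'
      have hcc' : inputsOf G x c' = (inputsOf G x c)ᶜ := by rw [hcc, compl_compl]
      have hbc : G.Adj b c := h.adj_dual hn hc hadj (by rw [hb', compl_compl]) hcc
      obtain ⟨z', hz', hzz⟩ := ih z c c' hcc' hc'
      refine ⟨z', ?_, hzz⟩
      rw [add_comm]
      exact (Steps.single hbc).trans hz'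
  -- A path into `a` longer than `m`, continued along the second half of the longest path, would
  -- beat `l`; dually for paths out of `a`.
  have hA : #(inputsOf G x a) ≤ 2 ^ m := h.card_inputsOf_le_two_pow fun k z hz => by
    have := hmax _ (h.acyclic.hasSimplePath (hz.trans h2))
    omega
  have hA' : #(inputsOf G x a') ≤ 2 ^ (l - m) := h.card_inputsOf_le_two_pow fun k z hz => by
    obtain ⟨z', hz', -⟩ := hrev k z a a' ha' hz
    have := hmax _ (h.acyclic.hasSimplePath (h1.trans hz'))
    omega
  rw [ha', card_compl, Fintype.card_fin] at hA'
  omega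

end IsLeaveOneOut

lemma hasSimplePath_bddAbove {V : Type} [Finite V] (G : Digraph V) :
    BddAbove {k : ℕ | HasSimplePath G k} := by
  refine ⟨Nat.card V, ?_⟩
  rintro k ⟨v, hv, -⟩
  have := Nat.card_le_card_of_injective v hv
  rw [Nat.card_eq_fintype_card, Fintype.card_fin] at this
  omega

namespace NodeStructure

variable {n : ℕ} (S : NodeStructure n)

lemma isLeaveOneOut : IsLeaveOneOut S.graph S.x S.y where
  acyclic := S.isStructure.acyclic
  mem_inputs_iff := S.isStructure.mem_inputs_iff
  entering_isDBT := S.isStructure.entering_isDBT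
  outputs := S.outputs
  leaves_y := S.leaves_y

lemma complexity_eq_card [Finite S.Node] :
    S.complexity = #(IsLeaveOneOut.computationNodes S.x) :=
  Set.ncard_eq_toFinset_card _ _

theorem complexity_ge (hn : 3 ≤ n) : 3 * n - 6 ≤ S.complexity := by
  have := S.finite_node
  rw [complexity_eq_card]
  exact S.isLeaveOneOut.card_computationNodes_ge hn

lemma hasSimplePath_latency [Nonempty S.Node] : HasSimplePath S.graph S.latency := by
  have := S.finite_node
  have : (S.latency) ∈ {k : ℕ | HasSimplePath S.graph k} :=
    Nat.sSup_mem ⟨0, fun _ => Classical.arbitrary _, fun i j _ => by omega, fun i => i.elim0⟩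
      (hasSimplePath_bddAbove _)
  exact this

theorem card_le_of_latency (hn : 3 ≤ n) (hc : S.complexity = 3 * n - 6) {m : ℕ}
    (hm : m ≤ S.latency) : n ≤ 2 ^ m + 2 ^ (S.latency - m) := by
  have := S.finite_node
  have : Nonempty S.Node := ⟨S.x ⟨0, by omega⟩⟩
  rw [complexity_eq_card] at hc
  exact S.isLeaveOneOut.card_le_two_pow_add_two_pow hn hc.le hm S.hasSimplePath_latency
    fun k hk => le_csSup (hasSimplePath_bddAbove _) hk

end NodeStructure

/-! ### Criteria for being a structure -/

lemma reach_subset {V W : Type} {G : Digraph V} {side : V → Set W}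
    (hmono : ∀ a b, G.Adj a b → side a ⊂ side b) {a b : V} (h : Reach G a b) :
    side a ⊆ side b := by
  induction h with
  | refl => exact subset_rfl
  | tail _ hbc ih => exact ih.trans (hmono _ _ hbc).subset

lemma isAcyclic_of_ssubset {V W : Type} {G : Digraph V} {side : V → Set W}
    (hmono : ∀ a b, G.Adj a b → side a ⊂ side b) : IsAcyclic G := by
  intro a ha
  obtain ⟨b, hab, hba⟩ := Relation.TransGen.head'_iff.1 ha
  exact (hmono a b hab).not_subset (reach_subset hmono hba)

lemma reach_entering {V : Type} {G : Digraph V} {a : V} (v : {b : V // Reach G b a}) :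
    Reach (entering G a) v ⟨a, Relation.ReflTransGen.refl⟩ := by
  obtain ⟨v, hv⟩ := v
  induction hv using Relation.ReflTransGen.head_induction_on with
  | refl => exact Relation.ReflTransGen.refl
  | head hvp hpa ih =>
    exact Relation.ReflTransGen.head (show (entering G a).Adj ⟨_, _⟩ ⟨_, hpa⟩ from hvp) ih

/-- If the nodes carry nonempty sets which grow along the edges and are disjoint for siblings, and
every node has no or two children, then the subgraphs `E(a, G)` are directed binary trees. -/
theorem isDBT_entering {V W : Type} {G : Digraph V} {side : V → Set W}
    (hmono : ∀ a b, G.Adj a b → side a ⊂ side b) (hne : ∀ a, (side a).Nonempty)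
    (hdisj : ∀ a b c, G.Adj b a → G.Adj c a → b ≠ c → Disjoint (side b) (side c))
    (hchild : ∀ a, (∀ b, ¬ G.Adj b a) ∨ ∃ b c, b ≠ c ∧ ∀ d, G.Adj d a ↔ d = b ∨ d = c) (a : V) :
    IsDBT (entering G a) ⟨a, Relation.ReflTransGen.refl⟩ := by
  have hsub : ∀ {a b}, Reach G a b → side a ⊆ side b := fun h => reach_subset hmono h
  have hno : ∀ {a b}, Reach G a b → ¬ G.Adj b a := fun h h' =>
    (hmono _ _ h').not_subset (hsub h)
  -- The nonempty set of `v` would lie in the disjoint sets of two siblings.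
  have hsib : ∀ v a b c, Reach G v b → Reach G v c → G.Adj b a → G.Adj c a → b = c := by
    intro v a b c hb hc hba hca
    by_contra hbc
    obtain ⟨w, hw⟩ := hne v
    exact Set.disjoint_left.1 (hdisj a b c hba hca hbc) (hsub hb hw) (hsub hc hw)
  have hone : ∀ v p q, G.Adj v p → G.Adj v q → Reach G q p → p = q := by
    intro v p q hp hq hqp
    rcases Relation.ReflTransGen.cases_tail hqp with e | ⟨c, hqc, hcp⟩
    · exact e
    · have : c = v := hsib v p c v (Relation.ReflTransGen.head hq hqc)
        Relation.ReflTransGen.refl hcp hp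
      exact absurd hq (hno (this ▸ hqc))
  -- The paths from `p` and `q` to `r` are peeled from the end: their last edges have the same tail
  -- by `hsib`.
  have huniq : ∀ r v p q, G.Adj v p → G.Adj v q → Reach G p r → Reach G q r → p = q := by
    intro r v p q hp hq hpr hqr
    induction hpr with
    | refl => exact hone v p q hp hq hqr
    | tail hpc hcr ih =>
      rename_i c r
      rcases Relation.ReflTransGen.cases_tail hqr with e | ⟨d, hqd, hdr⟩
      · subst e
        exact (hone v r p hq hp (hpc.tail hcr)).symm
      · have : d = c := hsib v r d c (Relation.ReflTransGen.head hq hqd)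
          (Relation.ReflTransGen.head hp hpc) hdr hcr
        exact ih (this ▸ hqd)
  refine ⟨reach_entering, fun v hv => hno v.2 hv, ?_, ?_⟩
  · rintro ⟨v, hv⟩ hva
    rcases Relation.ReflTransGen.cases_head hv with e | ⟨p, hvp, hpa⟩
    · subst e
      exact absurd rfl hva
    · refine ⟨⟨p, hpa⟩, hvp, ?_⟩
      rintro ⟨q, hqa⟩ hvq
      exact Subtype.ext (huniq a v q p hvq hvp hqa hpa)
  · rintro ⟨v, hv⟩
    rcases hchild v with h0 | ⟨b, c, hbc, hch⟩
    · left
      exact Set.eq_empty_of_forall_notMem fun c hc => h0 c.1 hc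
    · right
      refine Set.ncard_eq_two.2 ⟨⟨b, Relation.ReflTransGen.head ((hch b).2 (Or.inl rfl)) hv⟩,
        ⟨c, Relation.ReflTransGen.head ((hch c).2 (Or.inr rfl)) hv⟩,
        fun e => hbc (congrArg Subtype.val e), ?_⟩
      ext d
      refine (hch d.1).trans ?_
      simp [Subtype.ext_iff]

/-- A label-respecting isomorphism fixes the inputs, so distinct input sets suffice for distinct
subtrees. -/
lemma SameSubtree.inputsOf_eq {V : Type} {n : ℕ} {G : Digraph V} {x : Fin n ↪ V} {a b : V}
    (h : SameSubtree G (Set.range x) a b) : inputsOf G x a = inputsOf G x b := by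
  obtain ⟨φ, -, hφ⟩ := h
  ext i
  rw [mem_inputsOf, mem_inputsOf]
  constructor
  · intro hi
    have : (φ ⟨x i, hi⟩).1 = x i := hφ ⟨x i, hi⟩ (Or.inl ⟨i, rfl⟩)
    exact this ▸ (φ ⟨x i, hi⟩).2
  · intro hi
    have := hφ (φ.symm ⟨x i, hi⟩) (Or.inr (by rw [Equiv.apply_symm_apply]; exact ⟨i, rfl⟩))
    rw [Equiv.apply_symm_apply] at this
    exact (show x i = _ from this) ▸ (φ.symm ⟨x i, hi⟩).2

/-- With at most `3 n - 6` computation nodes, different nodes have different subtrees. -/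
noncomputable def IsLeaveOneOut.toNodeStructure {V : Type} [Finite V] {n : ℕ} {G : Digraph V}
    {x y : Fin n ↪ V} (h : IsLeaveOneOut G x y) (hn : 3 ≤ n)
    (hc : #(computationNodes x) ≤ 3 * n - 6) : NodeStructure n where
  Node := V
  finite_node := inferInstance
  graph := G
  x := x
  y := y
  isStructure :=
    { acyclic := h.acyclic
      mem_inputs_iff := h.mem_inputs_iff
      entering_isDBT := h.entering_isDBT
      not_same := fun _ _ hab hs => hab (h.inputsOf_injective hn hc hs.inputsOf_eq) }
  outputs := h.outputs
  leaves_y := h.leaves_y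

/-! ### Oriented edges of a tree -/

section Tree

variable {V : Type} {G : SimpleGraph V}

lemma exists_adj_closer (hG : G.IsTree) {w v : V} (h : v ≠ w) :
    ∃ u, G.Adj u v ∧ G.dist w v = G.dist w u + 1 := by
  obtain ⟨p, hp, hlen⟩ := hG.connected.exists_path_of_dist w v
  have hnil : ¬ p.Nil := fun hnil => h hnil.eq.symm
  refine ⟨p.penultimate, p.adj_penultimate hnil, ?_⟩
  have h1 := G.dist_le p.dropLast
  have h2 : p.dropLast.length + 1 = p.length := p.length_dropLast_add_one hnil
  have := hG.dist_eq_dist_add_one_of_adj w (p.adj_penultimate hnil)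
  omega

lemma closer_unique (hG : G.IsTree) {w v u u' : V} (hu : G.Adj u v) (hu' : G.Adj u' v)
    (h : G.dist w v = G.dist w u + 1) (h' : G.dist w v = G.dist w u' + 1) : u = u' := by
  obtain ⟨p, hp, hlen⟩ := hG.connected.exists_path_of_dist w v
  have key : ∀ t, G.Adj t v → G.dist w v = G.dist w t + 1 → t = p.penultimate := by
    intro t ht hd
    obtain ⟨q, -, hq⟩ := hG.connected.exists_path_of_dist w t
    have hc : (q.concat ht).IsPath :=
      SimpleGraph.Walk.isPath_of_length_eq_dist _ (by rw [SimpleGraph.Walk.length_concat, hq, hd])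
    have : q.concat ht = p := congrArg Subtype.val
      ((hG.isAcyclic.subsingleton_path w v).elim ⟨_, hc⟩ ⟨p, hp⟩)
    rw [← this, SimpleGraph.Walk.penultimate_concat]
  rw [key u hu h, key u' hu' h']

/-- The digraph of the darts of `G`, a dart `(u, v)` being followed by the darts `(v, w)` with
`w ≠ u`. -/
def dartDigraph (G : SimpleGraph V) : Digraph G.Dart where
  Adj a b := a.snd = b.fst ∧ b.snd ≠ a.fst

/-- The vertices closer to the tail than to the head of a dart. -/
def dartSide (a : G.Dart) : Set V := {w | G.dist w a.snd = G.dist w a.fst + 1}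

/-- Otherwise `a.fst` and `b.snd` would both be the unique neighbour of `b.fst` closer to `w`, and
the step from `a` to `b` would backtrack. -/
lemma farther_of_adj (hG : G.IsTree) {a b : G.Dart} (hab : (dartDigraph G).Adj a b) {w : V}
    (hw : w ∈ dartSide a) : w ∈ dartSide b := by
  obtain ⟨h1, h2⟩ := hab
  simp only [dartSide, Set.mem_ofPred_eq] at hw ⊢
  rcases hG.dist_eq_dist_add_one_of_adj w b.adj with h | h
  · exfalso
    exact h2 (closer_unique hG b.adj.symm (h1 ▸ a.adj) h (h1 ▸ hw))
  · exact h

lemma fst_mem_dartSide (a : G.Dart) : a.fst ∈ dartSide a := by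
  have : G.dist a.fst a.snd = 1 := SimpleGraph.dist_eq_one_iff_adj.2 a.adj
  simp [dartSide, this]

lemma snd_notMem_dartSide (a : G.Dart) : a.snd ∉ dartSide a := by
  simp [dartSide]

lemma dartSide_ssubset (hG : G.IsTree) (a b : G.Dart) (hab : (dartDigraph G).Adj a b) :
    dartSide a ⊂ dartSide b := by
  refine ⟨fun w hw => farther_of_adj hG hab hw, fun h => ?_⟩
  have := h (fst_mem_dartSide b)
  rw [← hab.1] at this
  exact snd_notMem_dartSide a this

lemma dartSide_disjoint (hG : G.IsTree) (a b c : G.Dart) (hb : (dartDigraph G).Adj b a)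
    (hc : (dartDigraph G).Adj c a) (hbc : b ≠ c) : Disjoint (dartSide b) (dartSide c) := by
  rw [Set.disjoint_left]
  intro w hwb hwc
  simp only [dartSide, Set.mem_ofPred_eq] at hwb hwc
  have hs : b.snd = c.snd := hb.1.trans hc.1.symm
  rw [← hs] at hwc
  have hf : b.fst = c.fst := closer_unique hG b.adj (hs ▸ c.adj) hwb hwc
  exact hbc (SimpleGraph.Dart.ext _ _ (Prod.ext hf hs))

lemma exists_child_of_mem_dartSide (hG : G.IsTree) {a : G.Dart} {w : V} (hw : w ∈ dartSide a)
    (hne : w ≠ a.fst) : ∃ b, (dartDigraph G).Adj b a ∧ w ∈ dartSide b := by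
  obtain ⟨u, hu, hd⟩ := exists_adj_closer hG hne.symm
  refine ⟨⟨(u, a.fst), hu⟩, ⟨rfl, ?_⟩, hd⟩
  rintro (e : a.snd = u)
  simp only [dartSide, Set.mem_ofPred_eq] at hw
  rw [← e] at hd
  omega

/-- Non-backtracking walks in a tree are geodesics. -/
lemma dist_of_steps (hG : G.IsTree) {k : ℕ} {a b : G.Dart} (h : Steps (dartDigraph G) k a b) :
    G.dist a.fst b.fst = k ∧ a.fst ∈ dartSide b := by
  induction k generalizing b with
  | zero =>
    obtain rfl : a = b := h
    exact ⟨SimpleGraph.dist_self, fst_mem_dartSide a⟩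
  | succ k ih =>
    obtain ⟨c, hc, hcb⟩ := h
    obtain ⟨h1, h2⟩ := ih hc
    refine ⟨?_, farther_of_adj hG hcb h2⟩
    rw [← hcb.1, h2, h1]

end Tree

/-! ### Optimal structures from T-trees -/

namespace TTree

variable {n : ℕ} (T : TTree n) (hn : 3 ≤ n)

include hn in
lemma nontrivial : Nontrivial T.Node :=
  ⟨T.x ⟨0, by omega⟩, T.x ⟨1, by omega⟩, fun e => by simpa using T.x.injective e⟩

include hn in
lemma ncard_neighborSet_of_notMem {v : T.Node} (hv : v ∉ Set.range T.x) :
    (T.graph.neighborSet v).ncard = 3 := by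
  have := T.finite_node
  have := T.nontrivial hn
  have hpos : 0 < (T.graph.neighborSet v).ncard := by
    rw [Set.ncard_pos]
    obtain ⟨u, hu⟩ := T.isTree.connected.preconnected.exists_adj_of_nontrivial v
    exact ⟨u, hu⟩
  refine T.internal v ?_
  have : (T.graph.neighborSet v).ncard ≠ 1 := fun h => hv ((T.leaf_iff v).1 h)
  omega

lemma exists_leaf_neighbor (i : Fin n) : ∃ u, T.graph.neighborSet (T.x i) = {u} :=
  Set.ncard_eq_one.1 ((T.leaf_iff _).2 ⟨i, rfl⟩)

/-- The only neighbour of a leaf. -/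
noncomputable def leafNeighbor (i : Fin n) : T.Node := (T.exists_leaf_neighbor i).choose

lemma adj_leaf_iff {i : Fin n} {u : T.Node} : T.graph.Adj (T.x i) u ↔ u = T.leafNeighbor i := by
  have h : T.graph.neighborSet (T.x i) = {T.leafNeighbor i} :=
    (T.exists_leaf_neighbor i).choose_spec
  rw [← SimpleGraph.mem_neighborSet, h, Set.mem_singleton_iff]

/-- The dart leaving a leaf. -/
noncomputable def xDart : Fin n ↪ T.graph.Dart where
  toFun i := ⟨(T.x i, T.leafNeighbor i), T.adj_leaf_iff.2 rfl⟩
  inj' _ _ h := T.x.injective (congrArg (fun d : T.graph.Dart => d.fst) h)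

/-- The dart entering a leaf. -/
noncomputable def yDart : Fin n ↪ T.graph.Dart where
  toFun i := (T.xDart i).symm
  inj' _ _ h := T.xDart.injective (SimpleGraph.Dart.symm_involutive.injective h)

lemma mem_range_xDart {a : T.graph.Dart} : a ∈ Set.range T.xDart ↔ a.fst ∈ Set.range T.x := by
  constructor
  · rintro ⟨i, rfl⟩
    exact ⟨i, rfl⟩
  · rintro ⟨i, hi⟩
    refine ⟨i, SimpleGraph.Dart.ext _ _ (Prod.ext hi ?_)⟩
    have := a.adj
    rw [← hi] at this
    exact (T.adj_leaf_iff.1 this).symm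

lemma mem_range_yDart {a : T.graph.Dart} : a ∈ Set.range T.yDart ↔ a.snd ∈ Set.range T.x := by
  have h : a.snd ∈ Set.range T.x ↔ a.symm ∈ Set.range T.xDart :=
    (T.mem_range_xDart (a := a.symm)).symm
  rw [h]
  constructor
  · rintro ⟨i, rfl⟩
    exact ⟨i, (SimpleGraph.Dart.symm_symm _).symm⟩
  · rintro ⟨i, hi⟩
    refine ⟨i, ?_⟩
    change (T.xDart i).symm = a
    rw [hi, SimpleGraph.Dart.symm_symm]

lemma not_adj_xDart (i : Fin n) (b : T.graph.Dart) :
    ¬ (dartDigraph T.graph).Adj b (T.xDart i) := by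
  rintro ⟨h1, h2⟩
  have := b.adj.symm
  rw [h1] at this
  exact h2 (T.adj_leaf_iff.1 this).symm

-- The predecessors of a dart come from the other two of the three edges at its tail.
include hn in
lemma exists_children {a : T.graph.Dart} (ha : a ∉ Set.range T.xDart) :
    ∃ b c, b ≠ c ∧ ∀ d, (dartDigraph T.graph).Adj d a ↔ d = b ∨ d = c := by
  have := T.finite_node
  rw [mem_range_xDart] at ha
  have h3 := T.ncard_neighborSet_of_notMem hn ha
  have hmem : a.snd ∈ T.graph.neighborSet a.fst := a.adj
  have h2 := Set.ncard_sdiff_singleton_of_mem hmem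
  rw [h3] at h2
  obtain ⟨p, q, hpq, hset⟩ := Set.ncard_eq_two.1 h2
  have hp : T.graph.Adj a.fst p ∧ p ≠ a.snd := by
    have : p ∈ T.graph.neighborSet a.fst \ {a.snd} := by rw [hset]; exact Or.inl rfl
    exact this
  have hq : T.graph.Adj a.fst q ∧ q ≠ a.snd := by
    have : q ∈ T.graph.neighborSet a.fst \ {a.snd} := by rw [hset]; exact Or.inr rfl
    exact this
  refine ⟨⟨(p, a.fst), hp.1.symm⟩, ⟨(q, a.fst), hq.1.symm⟩,
    fun e => hpq (congrArg (fun d : T.graph.Dart => d.fst) e), fun d => ⟨?_, ?_⟩⟩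
  · rintro ⟨h1, h2⟩
    have : d.fst ∈ T.graph.neighborSet a.fst \ {a.snd} :=
      ⟨h1 ▸ d.adj.symm, fun e => h2 (Eq.symm e)⟩
    rw [hset] at this
    rcases this with e | e
    · exact Or.inl (SimpleGraph.Dart.ext _ _ (Prod.ext e h1))
    · exact Or.inr (SimpleGraph.Dart.ext _ _ (Prod.ext e h1))
  · rintro (rfl | rfl)
    · exact ⟨rfl, hp.2.symm⟩
    · exact ⟨rfl, hq.2.symm⟩

lemma reach_of_mem_dartSide {i : Fin n} (b : T.graph.Dart) (h : T.x i ∈ dartSide b) :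
    Reach (dartDigraph T.graph) (T.xDart i) b := by
  have := T.finite_node
  have : Finite T.graph.Dart := Finite.of_injective _ SimpleGraph.Dart.toProd_injective
  induction b using (isAcyclic_of_ssubset (dartSide_ssubset T.isTree)).wellFounded.induction with
  | _ b ih =>
    by_cases hb : T.x i = b.fst
    · obtain ⟨k, rfl⟩ := T.mem_range_xDart.2 ⟨i, hb⟩
      obtain rfl : i = k := T.x.injective hb
      exact Relation.ReflTransGen.refl
    · obtain ⟨c, hc, hic⟩ := exists_child_of_mem_dartSide T.isTree h hb
      exact (ih c hc hic).tail hc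

lemma reach_yDart_iff {i j : Fin n} :
    Reach (dartDigraph T.graph) (T.xDart i) (T.yDart j) ↔ i ≠ j := by
  constructor
  · rintro h rfl
    exact snd_notMem_dartSide (T.yDart i)
      (reach_subset (dartSide_ssubset T.isTree) h (fst_mem_dartSide _))
  · intro hij
    refine T.reach_of_mem_dartSide _ ?_
    obtain ⟨u, hu, hd⟩ := exists_adj_closer T.isTree
      (w := T.x i) (v := T.x j) (fun e => hij (T.x.injective e).symm)
    obtain rfl := T.adj_leaf_iff.1 hu.symm
    exact hd

include hn in
theorem isLeaveOneOut : IsLeaveOneOut (dartDigraph T.graph) T.xDart T.yDart where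
  acyclic := isAcyclic_of_ssubset (dartSide_ssubset T.isTree)
  mem_inputs_iff a := by
    constructor
    · rintro ⟨i, rfl⟩
      exact T.not_adj_xDart i
    · intro h
      by_contra ha
      obtain ⟨b, c, -, hbc⟩ := T.exists_children hn ha
      exact h b ((hbc b).2 (Or.inl rfl))
  entering_isDBT := by
    refine isDBT_entering (dartSide_ssubset T.isTree) (fun a => ⟨_, fst_mem_dartSide a⟩)
      (dartSide_disjoint T.isTree) fun a => ?_
    by_cases ha : a ∈ Set.range T.xDart
    · obtain ⟨i, rfl⟩ := ha
      exact Or.inl (T.not_adj_xDart i)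
    · exact Or.inr (T.exists_children hn ha)
  outputs := by
    ext a
    rw [Set.mem_ofPred_eq]
    constructor
    · rintro ⟨-, h⟩
      rw [mem_range_yDart]
      by_contra ha
      have := T.finite_node
      have h3 := T.ncard_neighborSet_of_notMem hn ha
      obtain ⟨p, hp, hne⟩ := Set.exists_ne_of_one_lt_ncard
        (show 1 < (T.graph.neighborSet a.snd).ncard by omega) a.fst
      exact h ⟨(a.snd, p), hp⟩ ⟨rfl, hne⟩
    · rintro ⟨j, rfl⟩
      constructor
      · intro hj
        obtain ⟨k, hk⟩ := hj
        have hall : ∀ i, i ≠ j → i = k := by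
          intro i hij
          have := T.reach_yDart_iff.2 hij
          rw [← hk] at this
          rcases Relation.ReflTransGen.cases_tail this with e | ⟨b, -, hb⟩
          · exact T.xDart.injective e.symm
          · exact absurd hb (T.not_adj_xDart k b)
        -- If `y j` were the input `x k`, no input but `x k` could reach it; a third index
        -- contradicts this.
        obtain ⟨p, hp⟩ : ∃ p : Fin n, p ∉ ({j, k} : Finset (Fin n)) := by
          by_contra! hcon
          have h1 := card_le_card (fun i _ => hcon i : univ ⊆ ({j, k} : Finset (Fin n)))
          rw [card_univ, Fintype.card_fin] at h1
          have := card_le_two (a := j) (b := k)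
          omega
        simp only [mem_insert, mem_singleton, not_or] at hp
        exact hp.2 (hall p hp.1)
      · rintro b ⟨h1, h2⟩
        have hb := b.adj
        rw [← h1] at hb
        exact h2 (T.adj_leaf_iff.1 hb)
  leaves_y j := by
    ext a
    constructor
    · rintro ⟨v, hv, rfl⟩
      have hx : v.1 ∈ Set.range T.xDart := by
        by_contra ha
        obtain ⟨b, c, -, hbc⟩ := T.exists_children hn ha
        have hb := (hbc b).2 (Or.inl rfl)
        exact hv ⟨b, Relation.ReflTransGen.head hb v.2⟩ hb
      refine ⟨hx, ?_⟩
      obtain ⟨i, hi⟩ := hx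
      have := v.2
      rw [← hi] at this ⊢
      intro e
      exact T.reach_yDart_iff.1 this (T.xDart.injective e)
    · rintro ⟨⟨i, rfl⟩, hij⟩
      have hij' : i ≠ j := fun e => hij (e ▸ rfl)
      exact ⟨⟨_, T.reach_yDart_iff.2 hij'⟩, fun c hc => T.not_adj_xDart i c.1 hc, rfl⟩

-- With `V` vertices, counting degrees gives `2(V - 1) = 3V - 2n`, so `V = 2n - 2`. There are `4n -
-- 6` darts, of which `n` are inputs.
include hn in
open scoped Classical in
theorem card_computationNodes [Finite T.graph.Dart] :
    #(IsLeaveOneOut.computationNodes T.xDart) ≤ 3 * n - 6 := by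
  have := T.finite_node
  have : Fintype T.Node := Fintype.ofFinite _
  have hE := T.isTree.card_edgeFinset
  have hD := T.graph.dart_card_eq_twice_card_edges
  have hS := T.graph.dart_card_eq_sum_degrees
  have hdeg : ∀ v, T.graph.degree v = if v ∈ Set.range T.x then 1 else 3 := by
    intro v
    have e : T.graph.degree v = (T.graph.neighborSet v).ncard := by
      rw [← SimpleGraph.card_neighborSet_eq_degree, ← Nat.card_eq_fintype_card]
      rfl
    rw [e]
    split_ifs with h
    · exact (T.leaf_iff v).2 h
    · exact T.ncard_neighborSet_of_notMem hn h
  have hsum : ∑ v, T.graph.degree v + 2 * n = 3 * Fintype.card T.Node := by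
    have h1 : ∑ v : T.Node, (if v ∈ Set.range T.x then 2 else 0) = 2 * n := by
      rw [← sum_filter, sum_const, smul_eq_mul, mul_comm]
      have : (univ.filter fun v => v ∈ Set.range T.x) = univ.map T.x := by
        ext v
        simp
      rw [this, card_map, card_univ, Fintype.card_fin]
    rw [← h1, ← sum_add_distrib, sum_congr rfl (g := fun _ => 3), sum_const, card_univ,
      smul_eq_mul, mul_comm]
    intro v _
    rw [hdeg]
    split_ifs <;> rfl
  have hcompl : IsLeaveOneOut.computationNodes T.xDart = (univ.map T.xDart)ᶜ := by
    ext a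
    rw [IsLeaveOneOut.mem_computationNodes]
    simp
  rw [hcompl, card_compl, card_map, card_univ, Fintype.card_fin]
  omega

lemma pathLengths_bddAbove :
    BddAbove {k : ℕ | ∃ (u v : T.Node) (p : T.graph.Walk u v), p.IsPath ∧ p.length = k} := by
  have := T.finite_node
  have : Fintype T.Node := Fintype.ofFinite _
  refine ⟨Fintype.card T.Node, ?_⟩
  rintro k ⟨u, v, p, hp, rfl⟩
  exact hp.length_lt.le

/-- A T-tree gives an optimal structure whose latency is less than the diameter of the tree. -/
theorem exists_nodeStructure (hn : 3 ≤ n) :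
    ∃ S : NodeStructure n, S.complexity = 3 * n - 6 ∧ S.latency + 1 ≤ T.diameter := by
  have := T.finite_node
  have : Finite T.graph.Dart := Finite.of_injective _ SimpleGraph.Dart.toProd_injective
  have hc := T.card_computationNodes hn
  set S := (T.isLeaveOneOut hn).toNodeStructure hn hc with hS
  have : Finite S.Node := S.finite_node
  refine ⟨S, le_antisymm ?_ (S.complexity_ge hn), ?_⟩
  · rw [S.complexity_eq_card]
    exact hc
  · have : Nonempty S.Node := ⟨S.x ⟨0, by omega⟩⟩
    obtain ⟨v, -, hv⟩ := S.hasSimplePath_latency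
    have h := Steps.of_path hv (i := 0) (j := S.latency) (by omega)
    -- A path of `k` steps visits `k + 1` darts, hence spans `k + 1` edges of the tree: this is the
    -- extra one in the diameter.
    obtain ⟨h1, h2⟩ := dist_of_steps T.isTree h
    simp only [dartSide, Set.mem_ofPred_eq] at h2
    rw [h1] at h2
    obtain ⟨p, hp, hlen⟩ := T.isTree.connected.exists_path_of_dist (V := T.Node) _ _
    exact le_csSup T.pathLengths_bddAbove ⟨_, _, p, hp, hlen.trans h2⟩

end TTree

end

/-! ### The balanced T-tree -/

/-- The tree on `0, …, 2 n - 3` in which `v ≥ 1` is joined to `v / 2 - 1`: a complete binary tree in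
heap order, with its root contracted. -/
def heapGraph (n : ℕ) : SimpleGraph (Fin (2 * n - 2)) where
  Adj u v := (1 ≤ (v : ℕ) ∧ (u : ℕ) = v / 2 - 1) ∨ (1 ≤ (u : ℕ) ∧ (v : ℕ) = u / 2 - 1)
  symm := ⟨fun _ _ h => h.symm⟩
  loopless := ⟨fun u h => by omega⟩

lemma heapGraph_adj {n : ℕ} {u v : Fin (2 * n - 2)} : (heapGraph n).Adj u v ↔
    (1 ≤ (v : ℕ) ∧ (u : ℕ) = v / 2 - 1) ∨ (1 ≤ (u : ℕ) ∧ (v : ℕ) = u / 2 - 1) := Iff.rfl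

section

variable {n : ℕ} (hn : 3 ≤ n)

/-- Vertex `v` has heap index `v + 2`, so `0` and `1` are the children of the contracted root. At
depth `m` below `0` the indices run from `2 ^ (m + 1)` to `3 * 2 ^ m - 1`; those below `1` fill the
rest of the level. Truncated subtraction makes `0` the parent of `1`. -/
lemma exists_walk_left (h0 : 0 < 2 * n - 2) (m : ℕ) (v : Fin (2 * n - 2))
    (h1 : 2 ^ (m + 1) ≤ (v : ℕ) + 2)
    (h2 : (v : ℕ) + 2 < 3 * 2 ^ m) :
    ∃ p : (heapGraph n).Walk v ⟨0, h0⟩, p.length = m := by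
  induction m generalizing v with
  | zero =>
    obtain rfl : v = ⟨0, h0⟩ := Fin.ext (by simp at h2 ⊢; omega)
    exact ⟨.nil, rfl⟩
  | succ m ih =>
    have hpos := Nat.one_le_two_pow (n := m)
    rw [pow_succ, pow_succ] at h1
    rw [pow_succ] at h2
    obtain ⟨p, hp⟩ := ih ⟨v / 2 - 1, by omega⟩ (by rw [pow_succ]; simp only; omega)
      (by simp only; omega)
    exact ⟨.cons (heapGraph_adj.2 (Or.inr ⟨by omega, rfl⟩)) p, by simp [hp]⟩

lemma exists_walk_right (h0 : 1 < 2 * n - 2) (m : ℕ) (v : Fin (2 * n - 2))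
    (h1 : 3 * 2 ^ m ≤ (v : ℕ) + 2)
    (h2 : (v : ℕ) + 2 < 2 ^ (m + 2)) :
    ∃ p : (heapGraph n).Walk v ⟨1, h0⟩, p.length = m := by
  induction m generalizing v with
  | zero =>
    obtain rfl : v = ⟨1, h0⟩ := Fin.ext (by simp at h1 h2 ⊢; omega)
    exact ⟨.nil, rfl⟩
  | succ m ih =>
    have hpos := Nat.one_le_two_pow (n := m)
    rw [pow_succ] at h1
    rw [pow_succ, pow_succ, pow_succ] at h2
    obtain ⟨p, hp⟩ := ih ⟨v / 2 - 1, by omega⟩ (by simp only; omega)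
      (by rw [pow_succ, pow_succ]; simp only; omega)
    exact ⟨.cons (heapGraph_adj.2 (Or.inr ⟨by omega, rfl⟩)) p, by simp [hp]⟩

variable {p q : ℕ} (hp : n ≤ 2 ^ (p + 1)) (hq : n ≤ 3 * 2 ^ q)

-- The largest heap index is `2n - 1`, so the two bounds on `n` say that the halves below `0` and
-- `1` have heights at most `p` and `q`.
include hn hp hq in
lemma exists_walk_to_root (v : Fin (2 * n - 2)) :
    (∃ w : (heapGraph n).Walk v ⟨0, by omega⟩, w.length ≤ p) ∨
      ∃ w : (heapGraph n).Walk v ⟨1, by omega⟩, w.length ≤ q := by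
  have hv := v.2
  obtain ⟨m, h1, h2⟩ : ∃ m, 2 ^ (m + 1) ≤ (v : ℕ) + 2 ∧ (v : ℕ) + 2 < 2 ^ (m + 2) := by
    refine ⟨Nat.log 2 (v + 2) - 1, ?_⟩
    have hlog : 1 ≤ Nat.log 2 ((v : ℕ) + 2) := Nat.log_pos (by omega) (by omega)
    constructor
    · rw [Nat.sub_add_cancel hlog]
      exact Nat.pow_log_le_self 2 (by omega)
    · rw [show Nat.log 2 ((v : ℕ) + 2) - 1 + 2 = Nat.log 2 ((v : ℕ) + 2) + 1 by omega]
      exact Nat.lt_pow_succ_log_self (by omega) _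
  by_cases h : (v : ℕ) + 2 < 3 * 2 ^ m
  · obtain ⟨w, hw⟩ := exists_walk_left (by omega) m v h1 h
    refine Or.inl ⟨w, hw.le.trans ?_⟩
    have : 2 ^ (m + 1) < 2 ^ (p + 2) := by
      rw [pow_succ 2 (p + 1)]
      omega
    have := (Nat.pow_lt_pow_iff_right (by omega : 1 < 2)).1 this
    omega
  · obtain ⟨w, hw⟩ := exists_walk_right (by omega) m v (by omega) h2
    refine Or.inr ⟨w, hw.le.trans ?_⟩
    have : 2 ^ m < 2 ^ (q + 1) := by
      rw [pow_succ 2 q]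
      omega
    have := (Nat.pow_lt_pow_iff_right (by omega : 1 < 2)).1 this
    omega

include hn hp hq in
lemma exists_short_walk (hqp : q ≤ p) (hpq : p ≤ q + 1) (u v : Fin (2 * n - 2)) :
    ∃ w : (heapGraph n).Walk u v, w.length ≤ p + q + 1 := by
  have hadj : (heapGraph n).Adj ⟨0, by omega⟩ ⟨1, by omega⟩ :=
    heapGraph_adj.2 (Or.inl ⟨le_rfl, by simp⟩)
  rcases exists_walk_to_root hn hp hq u with ⟨w, hw⟩ | ⟨w, hw⟩ <;>
    rcases exists_walk_to_root hn hp hq v with ⟨w', hw'⟩ | ⟨w', hw'⟩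
  · exact ⟨w.append w'.reverse, by simp; omega⟩
  · exact ⟨w.append (.cons hadj w'.reverse), by simp; omega⟩
  · exact ⟨w.append (.cons hadj.symm w'.reverse), by simp; omega⟩
  · exact ⟨w.append w'.reverse, by simp; omega⟩

include hn in
lemma heapGraph_isTree : (heapGraph n).IsTree := by
  have : Nonempty (Fin (2 * n - 2)) := ⟨⟨0, by omega⟩⟩
  have hconn : (heapGraph n).Connected := by
    refine ⟨fun u v => ?_⟩
    have hlt := Nat.lt_two_pow_self (n := n)
    -- Only connectedness is needed, so the crude height `n` suffices.
    obtain ⟨w, -⟩ := exists_short_walk (p := n) (q := n) hn (by rw [pow_succ]; omega) (by omega)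
      le_rfl (by omega) u v
    exact ⟨w⟩
  rw [SimpleGraph.isTree_iff_connected_and_card]
  refine ⟨hconn, le_antisymm ?_ hconn.card_vert_le_card_edgeSet_add_one⟩
  -- Each edge joins some vertex `k + 1` to its parent, so there are at most `2n - 3` edges.
  let f : Fin (2 * n - 3) → Sym2 (Fin (2 * n - 2)) := fun k =>
    s(⟨k + 1, by omega⟩, ⟨(k + 1) / 2 - 1, by omega⟩)
  have hsub : (heapGraph n).edgeSet ⊆ f '' Set.univ := by
    intro e he
    induction e using Sym2.inductionOn with
    | hf u v =>
      rw [SimpleGraph.mem_edgeSet, heapGraph_adj] at he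
      rcases he with ⟨h1, h2⟩ | ⟨h1, h2⟩
      · refine ⟨⟨v - 1, by omega⟩, trivial, ?_⟩
        have e1 : (⟨(v : ℕ) - 1 + 1, by omega⟩ : Fin (2 * n - 2)) = v := Fin.ext (by simp; omega)
        have e2 : (⟨((v : ℕ) - 1 + 1) / 2 - 1, by omega⟩ : Fin (2 * n - 2)) = u :=
          Fin.ext (by simp only; omega)
        simp only [f, e1, e2]
        exact Sym2.eq_swap
      · refine ⟨⟨u - 1, by omega⟩, trivial, ?_⟩
        have e1 : (⟨(u : ℕ) - 1 + 1, by omega⟩ : Fin (2 * n - 2)) = u := Fin.ext (by simp; omega)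
        have e2 : (⟨((u : ℕ) - 1 + 1) / 2 - 1, by omega⟩ : Fin (2 * n - 2)) = v :=
          Fin.ext (by simp only; omega)
        simp only [f, e1, e2]
  have h1 := (Set.ncard_le_ncard hsub).trans (Set.ncard_image_le (Set.toFinite _))
  rw [Set.ncard_univ, Nat.card_eq_fintype_card, Fintype.card_fin] at h1
  rw [Nat.card_eq_fintype_card (α := Fin (2 * n - 2)), Fintype.card_fin]
  change Nat.card (heapGraph n).edgeSet ≤ _ at h1
  omega

lemma heapGraph_neighborSet_leaf {v : Fin (2 * n - 2)} (hn : 3 ≤ n) (hv : n - 2 ≤ (v : ℕ)) :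
    ((heapGraph n).neighborSet v).ncard = 1 := by
  refine Set.ncard_eq_one.2 ⟨⟨v / 2 - 1, by omega⟩, ?_⟩
  ext u
  simp only [SimpleGraph.mem_neighborSet, heapGraph_adj, Set.mem_singleton_iff, Fin.ext_iff]
  omega

lemma heapGraph_neighborSet_internal {v : Fin (2 * n - 2)} (hv : (v : ℕ) < n - 2) :
    ((heapGraph n).neighborSet v).ncard = 3 := by
  by_cases h0 : (v : ℕ) = 0
  · refine Set.ncard_eq_three.2 ⟨⟨1, by omega⟩, ⟨2, by omega⟩, ⟨3, by omega⟩, by simp, by simp,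
      by simp, ?_⟩
    ext u
    simp only [SimpleGraph.mem_neighborSet, heapGraph_adj, Set.mem_singleton_iff,
      Set.mem_insert_iff, Fin.ext_iff]
    omega
  · refine Set.ncard_eq_three.2 ⟨⟨v / 2 - 1, by omega⟩, ⟨2 * v + 2, by omega⟩,
      ⟨2 * v + 3, by omega⟩, ?_, ?_, ?_, ?_⟩
    · rw [Ne, Fin.ext_iff]; simp only; omega
    · rw [Ne, Fin.ext_iff]; simp only; omega
    · rw [Ne, Fin.ext_iff]; simp only; omega
    ext u
    simp only [SimpleGraph.mem_neighborSet, heapGraph_adj, Set.mem_singleton_iff,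
      Set.mem_insert_iff, Fin.ext_iff]
    omega

end

/-- The heap-ordered T-tree. -/
def heapTree (n : ℕ) (hn : 3 ≤ n) : TTree n where
  Node := Fin (2 * n - 2)
  finite_node := inferInstance
  graph := heapGraph n
  isTree := heapGraph_isTree hn
  x := ⟨fun i => ⟨i + (n - 2), by omega⟩, fun i j h => by
    have := congrArg Fin.val h
    exact Fin.ext (by simp only at this; omega)⟩
  leaf_iff v := by
    have hx : v ∈ Set.range (fun i : Fin n => (⟨i + (n - 2), by omega⟩ : Fin (2 * n - 2))) ↔
        n - 2 ≤ (v : ℕ) := by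
      constructor
      · rintro ⟨i, rfl⟩
        simp
      · intro h
        exact ⟨⟨v - (n - 2), by omega⟩, Fin.ext (by simp only; omega)⟩
    refine Iff.trans ?_ hx.symm
    by_cases h : n - 2 ≤ (v : ℕ)
    · simp [heapGraph_neighborSet_leaf hn h, h]
    · simp [heapGraph_neighborSet_internal (not_le.1 h), h]
  internal v hv := by
    by_cases h : n - 2 ≤ (v : ℕ)
    · rw [heapGraph_neighborSet_leaf hn h] at hv
      omega
    · exact heapGraph_neighborSet_internal (not_le.1 h)

theorem heapTree_diameter_le {n p q : ℕ} (hn : 3 ≤ n) (hp : n ≤ 2 ^ (p + 1))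
    (hq : n ≤ 3 * 2 ^ q) (hqp : q ≤ p)
    (hpq : p ≤ q + 1) : (heapTree n hn).diameter ≤ p + q + 1 := by
  refine csSup_le' (α := ℕ) ?_
  rintro k ⟨u, v, w, hw, rfl⟩
  obtain ⟨w', hw'⟩ := exists_short_walk hn hp hq hqp hpq u v
  have : w = w'.bypass := congrArg Subtype.val
    (((heapGraph_isTree hn).isAcyclic.subsingleton_path u v).elim ⟨w, hw⟩
      ⟨w'.bypass, w'.bypass_isPath⟩)
  rw [this]
  exact w'.length_bypass_le_length.trans hw'

/-! ### Arithmetic of the optimal value -/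

lemma floor_logb_half {n : ℕ} (hn : 2 ≤ n) : ⌊Real.logb 2 ((n : ℝ) / 2)⌋₊ = Nat.log 2 n - 1 := by
  have hn' : (n : ℝ) ≠ 0 := by positivity
  have h : Real.logb 2 ((n : ℝ) / 2) = Real.logb 2 n - 1 := by
    rw [Real.logb_div hn' two_ne_zero, Real.logb_self_eq_one (by norm_num)]
  have hpos : 0 ≤ Real.logb 2 n - 1 := by
    rw [← h]
    refine Real.logb_nonneg (by norm_num) ?_
    rw [le_div_iff₀ two_pos, one_mul]
    exact_mod_cast hn
  have h1 := Nat.floor_add_one hpos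
  rw [sub_add_cancel, show ⌊Real.logb 2 n⌋₊ = Nat.log 2 n from
    mod_cast Real.natFloor_logb_natCast 2 n] at h1
  rw [h]
  omega

/-- The latency `⌊log₂ (n / 2)⌋ + ⌈log₂ (n - 2 ^ ⌊log₂ (n / 2)⌋)⌉` splits into the two heights of
the heap-ordered T-tree, and is the least number satisfying the bound for optimal structures. -/
lemma optimal_latency_spec {n δ r : ℕ} (hn : 3 ≤ n) (hδ : δ = ⌊Real.logb 2 ((n : ℝ) / 2)⌋₊)
    (hr : r = δ + ⌈Real.logb 2 ((n : ℝ) - 2 ^ δ)⌉₊) :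
    (∃ p q, p + q = r ∧ n ≤ 2 ^ (p + 1) ∧ n ≤ 3 * 2 ^ q ∧ q ≤ p ∧ p ≤ q + 1) ∧
      ∀ l, (∀ m ≤ l, n ≤ 2 ^ m + 2 ^ (l - m)) → r ≤ l := by
  rw [floor_logb_half (by omega)] at hδ
  have hlog : 1 ≤ Nat.log 2 n := Nat.log_pos (by omega) (by omega)
  have h1 : 2 * 2 ^ δ ≤ n := by
    rw [← pow_succ', hδ, Nat.sub_add_cancel hlog]
    exact Nat.pow_log_le_self 2 (by omega)
  have h2 : n < 4 * 2 ^ δ := by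
    have : n < 2 ^ (Nat.log 2 n + 1) := Nat.lt_pow_succ_log_self (by omega) n
    rw [show Nat.log 2 n + 1 = δ + 2 by omega, pow_add] at this
    omega
  have hpos := Nat.one_le_two_pow (n := δ)
  have hceil : ⌈Real.logb 2 ((n : ℝ) - 2 ^ δ)⌉₊ = Nat.clog 2 (n - 2 ^ δ) := by
    have := Real.natCeil_logb_natCast 2 (n - 2 ^ δ)
    rw [Nat.cast_sub (by omega)] at this
    push_cast at this
    exact this
  rw [hceil] at hr
  have hle : ∀ k, Nat.clog 2 (n - 2 ^ δ) ≤ k ↔ n - 2 ^ δ ≤ 2 ^ k :=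
    fun k => Nat.clog_le_iff_le_pow (by omega)
  have hge : δ ≤ Nat.clog 2 (n - 2 ^ δ) := by
    by_contra hcon
    have h3 := (hle (δ - 1)).1 (by omega)
    have h4 : 2 ^ δ = 2 * 2 ^ (δ - 1) := by
      rw [← pow_succ', Nat.sub_add_cancel (by omega)]
    omega
  have hpow : ∀ {a b : ℕ}, a ≤ b → 2 ^ a ≤ 2 ^ b := fun h => Nat.pow_le_pow_right (by omega) h
  -- As `2 * 2 ^ δ ≤ n < 4 * 2 ^ δ`, the value is `2δ` if `n = 2 * 2 ^ δ`, `2δ + 1` for larger `n`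
  -- up to `3 * 2 ^ δ`, and `2δ + 2` beyond.
  by_cases c1 : n - 2 ^ δ ≤ 2 ^ δ
  · have e := le_antisymm ((hle δ).2 c1) hge
    refine ⟨⟨δ, δ, by omega, by rw [pow_succ]; omega, by omega, le_rfl, by omega⟩, ?_⟩
    intro l hl
    by_contra hlt
    -- The balanced cut gives the strongest bound.
    have h3 := hl (l / 2) (by omega)
    have h4 : 2 ^ δ = 2 * 2 ^ (δ - 1) := by
      rw [← pow_succ', Nat.sub_add_cancel (by omega)]
    have h5 := hpow (show l / 2 ≤ δ - 1 by omega)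
    have h6 := hpow (show l - l / 2 ≤ δ by omega)
    omega
  have g1 : δ + 1 ≤ Nat.clog 2 (n - 2 ^ δ) := by
    by_contra hcon
    exact c1 ((hle δ).1 (by omega))
  by_cases c2 : n - 2 ^ δ ≤ 2 ^ (δ + 1)
  · have e := le_antisymm ((hle (δ + 1)).2 c2) g1
    rw [pow_succ] at c2
    refine ⟨⟨δ + 1, δ, by omega, by rw [pow_succ, pow_succ]; omega, by omega, by omega, le_rfl⟩, ?_⟩
    intro l hl
    by_contra hlt
    have h3 := hl (l / 2) (by omega)
    have h5 := hpow (show l / 2 ≤ δ by omega)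
    have h6 := hpow (show l - l / 2 ≤ δ by omega)
    omega
  · have g2 : δ + 2 ≤ Nat.clog 2 (n - 2 ^ δ) := by
      by_contra hcon
      exact c2 ((hle (δ + 1)).1 (by omega))
    have e := le_antisymm ((hle (δ + 2)).2 (by rw [pow_add]; omega)) g2
    rw [pow_succ] at c2
    refine ⟨⟨δ + 1, δ + 1, by omega, by rw [pow_succ, pow_succ]; omega, by rw [pow_succ]; omega,
      le_rfl, by omega⟩, ?_⟩
    intro l hl
    by_contra hlt
    have h3 := hl (l / 2) (by omega)
    have h5 := hpow (show l / 2 ≤ δ by omega)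
    have h6 := hpow (show l - l / 2 ≤ δ + 1 by omega)
    rw [pow_succ] at h6
    omega

end NodeComputation

open NodeComputation in
theorem mainTheorem2 (n : ℕ) (hn : 3 ≤ n) (δ : ℕ) (hδ : δ = ⌊Real.logb 2 ((n : ℝ) / 2)⌋₊) :
    IsLeast (Set.range (NodeComputation.NodeStructure.complexity (n := n))) (3 * n - 6) ∧
    IsLeast (NodeComputation.NodeStructure.latency '' NodeComputation.complexityOptimal n)
      (δ + ⌈Real.logb 2 ((n : ℝ) - 2 ^ δ)⌉₊) ∧
    IsLeast (Set.range (NodeComputation.TTree.diameter (n := n)))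
      (δ + ⌈Real.logb 2 ((n : ℝ) - 2 ^ δ)⌉₊ + 1) := by
  obtain ⟨⟨p, q, hpqr, hp, hq, hqp, hpq⟩, hmin⟩ := optimal_latency_spec hn hδ rfl
  set r := δ + ⌈Real.logb 2 ((n : ℝ) - 2 ^ δ)⌉₊
  have hlat : ∀ S : NodeStructure n, S.complexity = 3 * n - 6 → r ≤ S.latency := fun S hS =>
    hmin _ fun m hm => S.card_le_of_latency hn hS hm
  have hdiam : ∀ T : TTree n, r + 1 ≤ T.diameter := fun T => by
    obtain ⟨S, hS, hST⟩ := T.exists_nodeStructure hn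
    have := hlat S hS
    omega
  -- The heap tree closes the chain `r + 1 ≤ latency + 1 ≤ diameter ≤ r + 1`, so its structure and
  -- the tree itself attain all the minima.
  have hT := heapTree_diameter_le hn hp hq hqp hpq
  obtain ⟨S, hS, hST⟩ := (heapTree n hn).exists_nodeStructure hn
  refine ⟨⟨⟨S, hS⟩, ?_⟩, ⟨⟨S, ?_, ?_⟩, ?_⟩, ⟨⟨heapTree n hn, ?_⟩, ?_⟩⟩
  · rintro _ ⟨S', rfl⟩
    exact S'.complexity_ge hn
  · intro S'
    rw [hS]
    exact S'.complexity_ge hn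
  · have := hlat S hS
    omega
  · rintro _ ⟨S', hS', rfl⟩
    exact hlat S' (le_antisymm (hS ▸ hS' S) (S'.complexity_ge hn))
  · have := hdiam (heapTree n hn)
    omega
  · rintro _ ⟨T, rfl⟩
    exact hdiam T
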